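/- **Setting.** Write $H(s)^H=H(-s^*)^\dagger$ for rational transfer matrices; matrix inequalities are in the sense of Hermitian matrices. Let $(A,B,C,D)$ be a minimal realization, with complex matrices, of $G(s)=C(sI-A)^{-1}B+D$, with $A+A^\dagger+BB^\dagger=0$, $B=-C^\dagger D$, $D^\dagger D=DD^\dagger=I$. It describes a completely passive quantum channel with inputs $(u,w)$ of dimensions $n,n_w$ and outputs $(y,d)$ of dimensions $n_y,n_d$; $G_{11},G_{12}$ are the blocks of $G$ from $u$ and $w$ to $y$. Let $\Sigma_u>0$, $\Sigma_w>0$ be the Hermitian intensity matrices of the uncorrelated thermal white inputs $u,w$ (with spectra $I+\Sigma_u^T$, $I+\Sigma_w^T$). Put $\Psi=G_{11}\Sigma_u^TG_{11}^H+G_{12}\Sigma_w^TG_{12}^H$ and $$\Phi=\begin{bmatrix}\Psi & -G_{11}(I+\Sigma_u^T)\\ -(I+\Sigma_u^T)G_{11}^H & \Sigma_u^T+2I\end{bmatrix}.$$ A filter is *admissible* if it is a proper rational $H(s)$ mapping $(y,z)\mapsto(\hat u,\hat z)$ ($z$ a vacuum noise of any dimension, spectrum $I$; $\hat u$ of dimension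 $n$) which is *stable* (all poles in the open left half-plane, analytic in $\mathrm{Re}\,s>-\tau$ for some $\tau>0$) and satisfies $H^HH=HH^H=I$. Let $P_e$ be the power spectrum density of $e=\hat u-u$, and let $\gamma_\circ$ be the infimum of all $\gamma>0$ for which some admissible $H$ gives $P_e(i\omega)<\gamma^2I$ for all $\omega\in\mathbb R$. For an admissible $H$ with $(1,1)$ block $H_{11}$ one has $P_e=[H_{11}\ I]\,\Phi\,[H_{11}\ I]^H$. For $\gamma>0$ let $\mathcal H^-_{11,\gamma}$ be the set of proper rational stable $n\times n_y$ matrices $H_{11}$ with $[H_{11}\ I]\,\Phi\,[H_{11}\ I]^H(i\omega)<\gamma^2I$ for all $\omega\in\mathbb R$ and $H_{11}(i\omega)H_{11}(i\omega)^\dagger<I$ for all $\omega\in\mathbb R\cup\{\pm\infty\}$, and let $\gamma_\circ''=\inf\{\gamma>0:\mathcal H^-_{11,\gamma}\ne\emptyset\}$. Suppose that for some $\lambda\ge0$ one has $\Phi+\mathrm{diag}(0,\lambda^2I_n)=\Upsilon\Upsilon^H$ with a rational $(n_y+n)\times p$ matrix $\Upsilon$, all poles of which lie in $\mathrm{Re}\,s<-\tau$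 for some $\tau>0$. Let $\left(A_\lambda,B_\lambda,\begin{bmatrix}C_{1}\\C_{2}\end{bmatrix},\begin{bmatrix}D_{1}\\D_{2}\end{bmatrix}\right)$ be a minimal realization of $\Upsilon$ of dimension $m$ (row blocks of sizes $n_y,n$), and let the columns of $N_c$ form a basis of $\mathrm{Ker}[C_1\ D_1]$. For real $\bar\gamma$ consider the inequalities in Hermitian $m\times m$ matrices $X_1,Y_1$ $$\bar\gamma^2>\lambda^2,\quad X_1>0,\quad Y_1>0,\quad A_\lambda X_1+X_1A_\lambda^\dagger+B_\lambda B_\lambda^\dagger<0,$$ $$\begin{bmatrix}N_c&0\\0&I\end{bmatrix}^\dagger\begin{bmatrix}A_\lambda^\dagger Y_1+Y_1A_\lambda&Y_1B_\lambda&C_2^\dagger\\B_\lambda^\dagger Y_1&-I&D_2^\dagger\\C_2&D_2&-\bar\gamma^2I\end{bmatrix}\begin{bmatrix}N_c&0\\0&I\end{bmatrix}<0,\quad \begin{bmatrix}X_1&I\\I&Y_1\end{bmatrix}\ge0,\tag{a}$$ and, for an integer $m_{11}\ge0$, the rank constraint $$\mathrm{rank}\begin{bmatrix}X_1&I\\I&Y_1\end{bmatrix}\le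 m+m_{11}.\tag{b}$$ For $A_{11},B_{11},C_{11},J_{11}$ of sizes $m_{11}\times m_{11}$, $m_{11}\times n_y$, $n\times m_{11}$, $n\times n_y$ and $\hat X=\hat X^\dagger>0$ of size $m+m_{11}$ consider the inequality $$\begin{bmatrix}\hat A^\dagger\hat X+\hat X\hat A&\hat X\hat B&\hat C^\dagger\\\hat B^\dagger\hat X&-\bar\gamma^2I&\hat D^\dagger\\\hat C&\hat D&-I\end{bmatrix}<0,\tag{c}$$ where $$\hat A=\begin{bmatrix}A_\lambda^\dagger&C_1^\dagger B_{11}^\dagger\\0&A_{11}^\dagger\end{bmatrix},\quad \hat B=\begin{bmatrix}C_1^\dagger J_{11}^\dagger+C_2^\dagger\\C_{11}^\dagger\end{bmatrix},\quad \hat C=[B_\lambda^\dagger\ \ D_1^\dagger B_{11}^\dagger],\quad \hat D=D_1^\dagger J_{11}^\dagger+D_2^\dagger,$$ which for fixed $\hat X,\bar\gamma$ is a linear matrix inequality in $(A_{11},B_{11},C_{11},J_{11})$. **Theorem.** Let $\bar\gamma$ be feasible for (a), with or without the rank constraint (b), and put $\gamma=(\bar\gamma^2-\lambda^2)^{1/2}$.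 Suppose that there is $\theta>0$ such that $$\theta\left(\Phi(i\omega)-\gamma^2\begin{bmatrix}0&0\\0&I_n\end{bmatrix}\right)-\begin{bmatrix}I_{n_y}&0\\0&-I_n\end{bmatrix}>0\qquad\forall\,\omega\in\mathbb R\cup\{\pm\infty\}.$$ Then $\gamma>0$, $\mathcal H^-_{11,\gamma}\neq\emptyset$ and $\gamma\ge\gamma_\circ''=\gamma_\circ$. Inequality (c) has a solution with state dimension $m_{11}$ for every $m_{11}$ such that $\bar\gamma$ is feasible for (a) together with (b), and also for $m_{11}=m$. For every $m_{11}$ and every solution of (c), $H_{11}(s)=C_{11}(sI-A_{11})^{-1}B_{11}+J_{11}$ belongs to $\mathcal H^-_{11,\gamma}$. -/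

import Mathlib

open Matrix
open scoped ComplexOrder

noncomputable section

namespace CoherentEqualization

/-! ### Rational transfer matrices -/

/-- A matrix of rational functions of the complex variable `s`. -/
abbrev TransferMatrix (a b : Type) : Type := Matrix a b (RatFunc ℂ)

/-- The ring endomorphism `q(s) ↦ conj (q (-conj s))` of `ℂ[s]`. -/
def polyParaConj : Polynomial ℂ →+* Polynomial ℂ :=
  Polynomial.eval₂RingHom (Polynomial.C.comp (starRingEnd ℂ)) (-Polynomial.X)

theorem polyParaConj_involutive (q : Polynomial ℂ) : polyParaConj (polyParaConj q) = q := by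
  have h : polyParaConj.comp polyParaConj = RingHom.id (Polynomial ℂ) := by
    ext <;> simp [polyParaConj]
  exact congrArg (fun f : Polynomial ℂ →+* Polynomial ℂ => f q) h

theorem polyParaConj_nonZeroDivisors :
    nonZeroDivisors (Polynomial ℂ) ≤ (nonZeroDivisors (Polynomial ℂ)).comap polyParaConj := by
  intro q hq
  have hq0 : q ≠ 0 := nonZeroDivisors.ne_zero hq
  refine mem_nonZeroDivisors_of_ne_zero ?_
  intro h
  apply hq0
  have h2 := polyParaConj_involutive q
  rw [show polyParaConj q = 0 from h, map_zero] at h2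
  exact h2.symm

/-- The ring endomorphism `f(s) ↦ conj (f (-conj s))` of the field of rational functions. -/
def ratParaConj : RatFunc ℂ →+* RatFunc ℂ :=
  RatFunc.mapRingHom polyParaConj polyParaConj_nonZeroDivisors

/-- The para-Hermitian conjugate `H(s)^H = H(-s*)†` of a rational transfer matrix. -/
def paraConj {a b : Type} (H : TransferMatrix a b) : TransferMatrix b a :=
  (H.map ratParaConj)ᵀ

/-- A constant complex matrix regarded as a transfer matrix. -/
def const {a b : Type} (M : Matrix a b ℂ) : TransferMatrix a b :=
  M.map RatFunc.C

/-- The value `H(s)` at a complex number `s` (meaningful when `s` is not a pole of `H`). -/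
def evalAt {a b : Type} (H : TransferMatrix a b) (s : ℂ) : Matrix a b ℂ :=
  H.map (fun f => RatFunc.eval (RingHom.id ℂ) s f)

/-- The value `H(iω)`. -/
def freq {a b : Type} (H : TransferMatrix a b) (ω : ℝ) : Matrix a b ℂ :=
  evalAt H (Complex.I * (ω : ℂ))

/-- `s` is a pole of `H`: a zero of the denominator of some entry in lowest terms. -/
def IsPole {a b : Type} (H : TransferMatrix a b) (s : ℂ) : Prop :=
  ∃ i j, (H i j).denom.IsRoot s

/-- Every entry is a proper rational function. -/
def IsProper {a b : Type} (H : TransferMatrix a b) : Prop :=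
  ∀ i j, (H i j).num.natDegree ≤ (H i j).denom.natDegree

/-- All poles lie in the open left half-plane, and the function is analytic in a half-plane
`Re s > -τ` with some `τ > 0`. -/
def IsStable {a b : Type} (H : TransferMatrix a b) : Prop :=
  (∀ s : ℂ, IsPole H s → s.re < 0) ∧
    ∃ τ : ℝ, 0 < τ ∧ ∀ s : ℂ, -τ < s.re → ¬ IsPole H s

/-- `P (H(iω))` for all `ω` in the closed real axis `ℝ ∪ {±∞}`; the value at `±∞` is the limit. -/
def OnClosedAxis {a b : Type} (H : TransferMatrix a b) (P : Matrix a b ℂ → Prop) : Prop :=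
  (∀ ω : ℝ, P (freq H ω)) ∧
    ∃ L : Matrix a b ℂ, Filter.Tendsto (freq H) (Filter.cocompact ℝ) (nhds L) ∧ P L

/-- `C (sI - A)⁻¹ B + D`. -/
def transfer {x a b : Type} [Fintype x] [DecidableEq x]
    (A : Matrix x x ℂ) (B : Matrix x b ℂ) (C : Matrix a x ℂ) (D : Matrix a b ℂ) :
    TransferMatrix a b :=
  const C * ((RatFunc.X : RatFunc ℂ) • (1 : TransferMatrix x x) - const A)⁻¹ * const B + const D

/-- `(A, B, C, D)` is a realization of `H` of the least possible state dimension
(this dimension is the McMillan degree of `H`). -/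
def IsMinimalRealization {k : ℕ} {a b : Type}
    (A : Matrix (Fin k) (Fin k) ℂ) (B : Matrix (Fin k) b ℂ)
    (C : Matrix a (Fin k) ℂ) (D : Matrix a b ℂ) (H : TransferMatrix a b) : Prop :=
  transfer A B C D = H ∧
    ∀ (k' : ℕ) (A' : Matrix (Fin k') (Fin k') ℂ) (B' : Matrix (Fin k') b ℂ)
      (C' : Matrix a (Fin k') ℂ) (D' : Matrix a b ℂ), transfer A' B' C' D' = H → k ≤ k'

/-! ### The channel -/

/-- A completely passive linear quantum channel with inputs `(u, w)` of dimensions `n, nw`,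
outputs `(y, d)` of dimensions `ny, nd`, `k` oscillator modes, and thermal input fields of
intensities `Σu`, `Σw`. -/
structure Channel (n nw ny nd k : ℕ) where
  A : Matrix (Fin k) (Fin k) ℂ
  B : Matrix (Fin k) (Fin n ⊕ Fin nw) ℂ
  C : Matrix (Fin ny ⊕ Fin nd) (Fin k) ℂ
  D : Matrix (Fin ny ⊕ Fin nd) (Fin n ⊕ Fin nw) ℂ
  Su : Matrix (Fin n) (Fin n) ℂ
  Sw : Matrix (Fin nw) (Fin nw) ℂ
  lyapunov : A + Aᴴ + B * Bᴴ = 0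
  coupling : B = -(Cᴴ * D)
  unitary_left : Dᴴ * D = 1
  unitary_right : D * Dᴴ = 1
  minimal : IsMinimalRealization A B C D (transfer A B C D)
  Su_posDef : Su.PosDef
  Sw_posDef : Sw.PosDef

namespace Channel

variable {n nw ny nd k : ℕ} (S : Channel n nw ny nd k)

/-- The transfer function `G(s) = D + C (sI - A)⁻¹ B`. -/
def G : TransferMatrix (Fin ny ⊕ Fin nd) (Fin n ⊕ Fin nw) := transfer S.A S.B S.C S.D

def G11 : TransferMatrix (Fin ny) (Fin n) := S.G.toBlocks₁₁

def G12 : TransferMatrix (Fin ny) (Fin nw) := S.G.toBlocks₁₂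

/-- `Ψ = G₁₁ Σuᵀ G₁₁^H + G₁₂ Σwᵀ G₁₂^H`. -/
def Psi : TransferMatrix (Fin ny) (Fin ny) :=
  S.G11 * const S.Suᵀ * paraConj S.G11 + S.G12 * const S.Swᵀ * paraConj S.G12

/-- The matrix `Φ`. -/
def Phi : TransferMatrix (Fin ny ⊕ Fin n) (Fin ny ⊕ Fin n) :=
  fromBlocks S.Psi (-(S.G11 * const (1 + S.Suᵀ)))
    (-(const (1 + S.Suᵀ) * paraConj S.G11)) (const (S.Suᵀ + (2 : ℂ) • 1))

/-- `Φ_λ = Φ + diag(0, λ² I)`. -/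
def PhiLam (lam : ℝ) : TransferMatrix (Fin ny ⊕ Fin n) (Fin ny ⊕ Fin n) :=
  S.Phi + const (fromBlocks 0 0 0 (((lam : ℂ) ^ 2) • 1))

/-- Power spectrum density of the error `e = û - u` when the filter `H`, whose environment `z`
is in the vacuum state, maps `(y, z)` to `(û, ẑ)`. The error is
`e = (H₁₁ G₁₁ - I) u + H₁₁ G₁₂ w + H₁₂ z`, and the uncorrelated white inputs `u`, `w`, `z` have
spectra `I + Σuᵀ`, `I + Σwᵀ`, `I`. -/
def errorPSD {nz nzh : ℕ} (H : TransferMatrix (Fin n ⊕ Fin nzh) (Fin ny ⊕ Fin nz)) :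
    TransferMatrix (Fin n) (Fin n) :=
  (H.toBlocks₁₁ * S.G11 - 1) * const (1 + S.Suᵀ) * paraConj (H.toBlocks₁₁ * S.G11 - 1)
    + (H.toBlocks₁₁ * S.G12) * const (1 + S.Swᵀ) * paraConj (H.toBlocks₁₁ * S.G12)
    + H.toBlocks₁₂ * paraConj H.toBlocks₁₂

/-- The error power spectrum density in terms of the block `H₁₁` alone:
`[H₁₁ I] Φ [H₁₁^H; I]`. -/
def blockPSD (H11 : TransferMatrix (Fin n) (Fin ny)) : TransferMatrix (Fin n) (Fin n) :=
  fromCols H11 (1 : Matrix (Fin n) (Fin n) (RatFunc ℂ)) * S.Phi *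
    fromRows (paraConj H11) (1 : Matrix (Fin n) (Fin n) (RatFunc ℂ))

end Channel

/-- Admissible (completely passive, physically realizable) filters: stable proper rational
functions which are paraunitary. The latter forces `n + nzh = ny + nz`. -/
def IsAdmissible {n ny nz nzh : ℕ}
    (H : TransferMatrix (Fin n ⊕ Fin nzh) (Fin ny ⊕ Fin nz)) : Prop :=
  IsProper H ∧ IsStable H ∧ paraConj H * H = 1 ∧ H * paraConj H = 1

/-- `P(iω) < γ² I` for all real `ω`. -/
def BoundedBySq {n : ℕ} (P : TransferMatrix (Fin n) (Fin n)) (γ : ℝ) : Prop :=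
  ∀ ω : ℝ, (((γ : ℂ) ^ 2) • (1 : Matrix (Fin n) (Fin n) ℂ) - freq P ω).PosDef

namespace Channel

variable {n nw ny nd k : ℕ} (S : Channel n nw ny nd k)

/-- The optimal equalization performance `γ∘` over all admissible filters, with an environment
of any dimension. (The infimum of the empty set would be `+∞`.) -/
def gammaOpt : EReal :=
  sInf ((fun γ : ℝ => (γ : EReal)) '' {γ : ℝ | 0 < γ ∧
    ∃ (nz nzh : ℕ) (H : TransferMatrix (Fin n ⊕ Fin nzh) (Fin ny ⊕ Fin nz)),
      IsAdmissible H ∧ BoundedBySq (S.errorPSD H) γ})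

/-- The set `H⁻_{11,γ}` of strictly contractive suboptimal transfer functions. -/
def contractiveSet (γ : ℝ) : Set (TransferMatrix (Fin n) (Fin ny)) :=
  {H11 | IsProper H11 ∧ IsStable H11 ∧ BoundedBySq (S.blockPSD H11) γ ∧
    OnClosedAxis H11 (fun M => (1 - M * Mᴴ).PosDef)}

/-- The value `γ∘''` of the auxiliary problem. -/
def gammaContractive : EReal :=
  sInf ((fun γ : ℝ => (γ : EReal)) '' {γ : ℝ | 0 < γ ∧ (S.contractiveSet γ).Nonempty})

/-- There is `θ > 0` such that
`θ (Φ(iω) - γ² diag(0, I)) - diag(I, -I) > 0` for all `ω ∈ ℝ ∪ {±∞}`. -/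
def LowSNRCondition (γ : ℝ) : Prop :=
  ∃ θ : ℝ, 0 < θ ∧ OnClosedAxis S.Phi (fun M =>
    ((θ : ℂ) • (M - fromBlocks 0 0 0 (((γ : ℂ) ^ 2) • 1)) - fromBlocks 1 0 0 (-1)).PosDef)

/-- `Φ_λ = Υ Υ^H`, where for some `τ > 0` all poles of `Υ` lie in `Re s < -τ`. -/
def IsSpectralFactor {p : ℕ} (lam : ℝ) (Ups : TransferMatrix (Fin ny ⊕ Fin n) (Fin p)) : Prop :=
  S.PhiLam lam = Ups * paraConj Ups ∧
    ∃ τ : ℝ, 0 < τ ∧ ∀ s : ℂ, IsPole Ups s → s.re < -τ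

end Channel

/-! ### Matrix inequalities -/

/-- State-space data `(A_λ, B_λ, [C₁; C₂], [D₁; D₂])`. -/
structure FactorData (m n ny p : ℕ) where
  A : Matrix (Fin m) (Fin m) ℂ
  B : Matrix (Fin m) (Fin p) ℂ
  C1 : Matrix (Fin ny) (Fin m) ℂ
  C2 : Matrix (Fin n) (Fin m) ℂ
  D1 : Matrix (Fin ny) (Fin p) ℂ
  D2 : Matrix (Fin n) (Fin p) ℂ

/-- State-space data `(A₁₁, B₁₁, C₁₁, J₁₁)` of a filter block. -/
structure FilterData (m11 n ny : ℕ) where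
  A : Matrix (Fin m11) (Fin m11) ℂ
  B : Matrix (Fin m11) (Fin ny) ℂ
  C : Matrix (Fin n) (Fin m11) ℂ
  J : Matrix (Fin n) (Fin ny) ℂ

/-- `H₁₁(s) = C₁₁ (sI - A₁₁)⁻¹ B₁₁ + J₁₁`. -/
def FilterData.toTransfer {m11 n ny : ℕ} (F : FilterData m11 n ny) :
    TransferMatrix (Fin n) (Fin ny) := transfer F.A F.B F.C F.J

/-- `K = [A₁₁† C₁₁†; B₁₁† J₁₁†]`. -/
def FilterData.K {m11 n ny : ℕ} (F : FilterData m11 n ny) :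
    Matrix (Fin m11 ⊕ Fin ny) (Fin m11 ⊕ Fin n) ℂ :=
  fromBlocks F.Aᴴ F.Cᴴ F.Bᴴ F.Jᴴ

/-- The block matrix `[M₁₁ M₁₂ M₁₃; M₂₁ M₂₂ M₂₃; M₃₁ M₃₂ M₃₃]`. -/
def blocks3 {a b c a' b' c' : Type}
    (M11 : Matrix a a' ℂ) (M12 : Matrix a b' ℂ) (M13 : Matrix a c' ℂ)
    (M21 : Matrix b a' ℂ) (M22 : Matrix b b' ℂ) (M23 : Matrix b c' ℂ)
    (M31 : Matrix c a' ℂ) (M32 : Matrix c b' ℂ) (M33 : Matrix c c' ℂ) :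
    Matrix ((a ⊕ b) ⊕ c) ((a' ⊕ b') ⊕ c') ℂ :=
  fromBlocks (fromBlocks M11 M12 M21 M22) (fromRows M13 M23) (fromCols M31 M32) M33

namespace FactorData

variable {m n ny p : ℕ} (R : FactorData m n ny p)

/-- `R` is a minimal state-space realization of `Υ`. -/
def IsMinimalRealizationOf (Ups : TransferMatrix (Fin ny ⊕ Fin n) (Fin p)) : Prop :=
  IsMinimalRealization R.A R.B (fromRows R.C1 R.C2) (fromRows R.D1 R.D2) Ups

def Abar (m11 : ℕ) : Matrix (Fin m ⊕ Fin m11) (Fin m ⊕ Fin m11) ℂ :=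
  fromBlocks R.Aᴴ 0 0 0

def Bbar (m11 : ℕ) : Matrix (Fin m ⊕ Fin m11) (Fin n) ℂ := fromRows R.C2ᴴ 0

def Cbar (m11 : ℕ) : Matrix (Fin p) (Fin m ⊕ Fin m11) ℂ := fromCols R.Bᴴ 0

def Dbar : Matrix (Fin p) (Fin n) ℂ := R.D2ᴴ

def Bund (m11 : ℕ) : Matrix (Fin m ⊕ Fin m11) (Fin m11 ⊕ Fin ny) ℂ :=
  fromBlocks 0 R.C1ᴴ 1 0

def D12und (m11 : ℕ) : Matrix (Fin p) (Fin m11 ⊕ Fin ny) ℂ := fromCols 0 R.D1ᴴ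

/-- The matrix `Σ_X̂` with the parameter `γ̄`. -/
def SigmaX {m11 : ℕ} (γbar : ℝ) (X : Matrix (Fin m ⊕ Fin m11) (Fin m ⊕ Fin m11) ℂ) :
    Matrix (((Fin m ⊕ Fin m11) ⊕ Fin n) ⊕ Fin p) (((Fin m ⊕ Fin m11) ⊕ Fin n) ⊕ Fin p) ℂ :=
  blocks3
    ((R.Abar m11)ᴴ * X + X * R.Abar m11) (X * R.Bbar m11) (R.Cbar m11)ᴴ
    ((R.Bbar m11)ᴴ * X) (-(((γbar : ℂ) ^ 2) • 1)) R.Dbarᴴ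
    (R.Cbar m11) R.Dbar (-1)

/-- The matrix `Λ_X̂`. -/
def LambdaX {m11 : ℕ} (X : Matrix (Fin m ⊕ Fin m11) (Fin m ⊕ Fin m11) ℂ) :
    Matrix (Fin m11 ⊕ Fin ny) (((Fin m ⊕ Fin m11) ⊕ Fin n) ⊕ Fin p) ℂ :=
  fromCols (fromCols ((R.Bund m11)ᴴ * X) 0) (R.D12und m11)ᴴ

/-- The matrix `Π = [C̲ D̲₂₁ 0]`. -/
def PiMat (m n p m11 : ℕ) :
    Matrix (Fin m11 ⊕ Fin n) (((Fin m ⊕ Fin m11) ⊕ Fin n) ⊕ Fin p) ℂ :=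
  fromCols (fromCols (fromBlocks 0 1 0 0) (fromRows 0 1)) 0

/-- `X̂ = X̂† > 0` and `Σ_X̂ + Π† K† Λ_X̂ + Λ_X̂† K Π < 0`. -/
def FilterLMI {m11 : ℕ} (γbar : ℝ) (F : FilterData m11 n ny)
    (X : Matrix (Fin m ⊕ Fin m11) (Fin m ⊕ Fin m11) ℂ) : Prop :=
  X.PosDef ∧
    (-(R.SigmaX γbar X + (PiMat m n p m11)ᴴ * F.Kᴴ * R.LambdaX X
        + (R.LambdaX X)ᴴ * F.K * PiMat m n p m11)).PosDef

/-- The columns of `Nc` form a basis of `Ker [C₁ D₁]`. -/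
def IsKernelBasis {q : ℕ} (Nc : Matrix (Fin m ⊕ Fin p) (Fin q) ℂ) : Prop :=
  Nc.rank = q ∧
    LinearMap.range (Matrix.mulVecLin Nc) =
      LinearMap.ker (Matrix.mulVecLin (fromCols R.C1 R.D1))

/-- The linear matrix inequalities (without the rank constraint) for `γ̄`, `X₁`, `Y₁`. -/
def SatisfiesLMIs {q : ℕ} (lam : ℝ) (Nc : Matrix (Fin m ⊕ Fin p) (Fin q) ℂ) (γbar : ℝ)
    (X1 Y1 : Matrix (Fin m) (Fin m) ℂ) : Prop :=
  lam ^ 2 < γbar ^ 2 ∧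
  X1.PosDef ∧ Y1.PosDef ∧
  (-(R.A * X1 + X1 * R.Aᴴ + R.B * R.Bᴴ)).PosDef ∧
  (-((fromBlocks Nc 0 0 (1 : Matrix (Fin n) (Fin n) ℂ))ᴴ *
      blocks3
        (R.Aᴴ * Y1 + Y1 * R.A) (Y1 * R.B) R.C2ᴴ
        (R.Bᴴ * Y1) (-1) R.D2ᴴ
        R.C2 R.D2 (-(((γbar : ℂ) ^ 2) • 1)) *
      fromBlocks Nc 0 0 (1 : Matrix (Fin n) (Fin n) ℂ))).PosDef ∧
  (fromBlocks X1 1 1 Y1).PosSemidef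

/-- `γ̄` is feasible for the problem without the rank constraint. -/
def Feasible {q : ℕ} (lam : ℝ) (Nc : Matrix (Fin m ⊕ Fin p) (Fin q) ℂ) (γbar : ℝ) : Prop :=
  ∃ X1 Y1, R.SatisfiesLMIs lam Nc γbar X1 Y1

/-- `γ̄` is feasible for the problem with the rank constraint
`rank [X₁ I; I Y₁] ≤ m + m₁₁`. -/
def RankFeasible {q : ℕ} (m11 : ℕ) (lam : ℝ) (Nc : Matrix (Fin m ⊕ Fin p) (Fin q) ℂ)
    (γbar : ℝ) : Prop :=
  ∃ X1 Y1, R.SatisfiesLMIs lam Nc γbar X1 Y1 ∧ (fromBlocks X1 1 1 Y1).rank ≤ m + m11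

end FactorData

end CoherentEqualization

end

set_option linter.unusedSimpArgs false

noncomputable section

namespace CoherentEqualization

/-! ### Rational functions -/

/-! The argument has three independent parts: solvability of the filter inequality, the meaning of
its solutions, and the comparison of the two optimal values.

Solvability. For fixed X̂ the inequality is affine in the filter matrix K, of the form Σ + Π†K†Λ +
Λ†KΠ < 0, so by the projection lemma (`projection_lemma`, which rests on `finsler`) it suffices that
Σ is negative on Ker Π and on Ker Λ. The certificate is X̂ = [X₁ V; V† I] with VV† = X₁ - Y₁⁻¹. The
coupling inequality makes X₁ - Y₁⁻¹ positive semidefinite, and the rank of [X₁ I; I Y₁] is at least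
m plus the rank of X₁ - Y₁⁻¹, so V may be taken with m₁₁ columns (`exists_completion`). Since the
(1,1) block of X̂ is X₁ and that of X̂⁻¹ is Y₁, the two kernel conditions become exactly the
inequalities assumed for X₁ and for Y₁. For m₁₁ = m the rank bound is automatic.

Meaning of a solution. The inequality is the bounded real inequality for the dual of Q = [H₁₁ I]Υ.
Its corner is a Lyapunov inequality, which gives stability, and a congruence at each frequency gives
QQ† < γ̄². Because [H₁₁ I]Φ[H₁₁ I]^H = QQ^H - λ², the error density lies below γ². Compressing the
low signal-to-noise condition by [H₁₁ I] then yields I - H₁₁H₁₁† > θ(γ² - P_e) ≥ 0, so any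
suboptimal H₁₁ is strictly contractive (`strictly_contractive_of_bounded`), also at infinity.

Equality of the values. Up to level γ, the last remark puts the block of every admissible filter in
the contractive set, and above γ the nonempty set at level γ is enough. Conversely a stable strictly
contractive H₁₁ is the corner of an admissible filter
(`exists_isAdmissible_of_strictly_contractive`): factor I - H₁₁H₁₁^H = WW^H, make W stable by a
scalar inner multiplier, and complete the co-isometric row [H₁₁ cW] to a paraunitary matrix. The
factorization only has to be regular on the closed axis, since inner multipliers afterwards remove
the poles on the right; hence no choice of half-plane for the zeros is needed. -/

theorem ratParaConj_algebraMap (q : Polynomial ℂ) :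
    ratParaConj (algebraMap (Polynomial ℂ) (RatFunc ℂ) q) =
      algebraMap (Polynomial ℂ) (RatFunc ℂ) (polyParaConj q) := by
  have h := RatFunc.map_apply_div_ne_zero polyParaConj polyParaConj_nonZeroDivisors q 1 one_ne_zero
  rw [map_one, map_one, map_one, div_one, div_one] at h
  exact h

theorem ratParaConj_apply (f : RatFunc ℂ) :
    ratParaConj f = algebraMap (Polynomial ℂ) (RatFunc ℂ) (polyParaConj f.num) /
      algebraMap (Polynomial ℂ) (RatFunc ℂ) (polyParaConj f.denom) := by
  conv_lhs => rw [← RatFunc.num_div_denom f]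
  rw [map_div₀, ratParaConj_algebraMap, ratParaConj_algebraMap]

theorem ratParaConj_involutive (f : RatFunc ℂ) : ratParaConj (ratParaConj f) = f := by
  rw [ratParaConj_apply f, map_div₀, ratParaConj_algebraMap, ratParaConj_algebraMap,
    polyParaConj_involutive, polyParaConj_involutive, RatFunc.num_div_denom]

/-- Para-Hermitian conjugation as a star operation, for which `paraConj` is `conjTranspose`. -/
instance ratFuncStarRing : StarRing (RatFunc ℂ) where
  star := ratParaConj
  star_involutive := ratParaConj_involutive
  star_mul f g := by rw [map_mul, mul_comm]
  star_add f g := map_add _ f g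

theorem star_ratFunc (f : RatFunc ℂ) : star f = ratParaConj f := rfl

theorem paraConj_eq_conjTranspose {a b : Type} (H : TransferMatrix a b) : paraConj H = Hᴴ := rfl

theorem star_algebraMap (q : Polynomial ℂ) :
    star (algebraMap (Polynomial ℂ) (RatFunc ℂ) q) =
      algebraMap (Polynomial ℂ) (RatFunc ℂ) (polyParaConj q) := ratParaConj_algebraMap q

theorem star_ratFunc_C (c : ℂ) : star (RatFunc.C c : RatFunc ℂ) = RatFunc.C (star c) := by
  rw [← RatFunc.algebraMap_C, star_algebraMap]
  simp [polyParaConj]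

theorem star_ratFunc_X : star (RatFunc.X : RatFunc ℂ) = -RatFunc.X := by
  rw [← RatFunc.algebraMap_X, star_algebraMap]
  simp [polyParaConj]

theorem polyParaConj_eval (q : Polynomial ℂ) (s : ℂ) :
    (polyParaConj q).eval s = star (q.eval (-star s)) := by
  induction q using Polynomial.induction_on' with
  | add p q hp hq => simp only [map_add, Polynomial.eval_add, hp, hq, star_add]
  | monomial n c => simp [polyParaConj]

theorem natDegree_polyParaConj (q : Polynomial ℂ) :
    (polyParaConj q).natDegree = q.natDegree := by
  have h : ∀ q : Polynomial ℂ, (polyParaConj q).natDegree ≤ q.natDegree := by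
    intro q
    have h1 : polyParaConj q = (q.map (starRingEnd ℂ)).comp (-Polynomial.X) := by
      rw [Polynomial.comp, Polynomial.eval₂_map]; rfl
    rw [h1]
    refine Polynomial.natDegree_comp_le.trans ?_
    simp
  refine le_antisymm (h q) ?_
  conv_lhs => rw [← polyParaConj_involutive q]
  exact h _

/-- The ring of rational functions without a pole at `s`. -/
def regularAt (s : ℂ) : Subring (RatFunc ℂ) where
  carrier := {f | ¬ f.denom.IsRoot s}
  one_mem' := by simp [Polynomial.IsRoot]
  zero_mem' := by simp [Polynomial.IsRoot]
  mul_mem' {f g} hf hg h := by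
    rcases Polynomial.root_mul.1 (h.dvd (RatFunc.denom_mul_dvd f g)) with h | h
    exacts [hf h, hg h]
  add_mem' {f g} hf hg h := by
    rcases Polynomial.root_mul.1 (h.dvd (RatFunc.denom_add_dvd f g)) with h | h
    exacts [hf h, hg h]
  neg_mem' {f} hf h := by
    refine hf (h.dvd ?_)
    rw [RatFunc.denom_dvd f.denom_ne_zero]
    exact ⟨-f.num, by rw [map_neg, neg_div, RatFunc.num_div_denom]⟩

theorem mem_regularAt {s : ℂ} {f : RatFunc ℂ} : f ∈ regularAt s ↔ ¬ f.denom.IsRoot s := Iff.rfl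

theorem div_mem_regularAt {s : ℂ} (p : Polynomial ℂ) {q : Polynomial ℂ} (hq : q.eval s ≠ 0) :
    algebraMap (Polynomial ℂ) (RatFunc ℂ) p / algebraMap (Polynomial ℂ) (RatFunc ℂ) q
      ∈ regularAt s :=
  fun h => hq (h.dvd (RatFunc.denom_div_dvd p q))

theorem algebraMap_mem_regularAt (s : ℂ) (p : Polynomial ℂ) :
    algebraMap (Polynomial ℂ) (RatFunc ℂ) p ∈ regularAt s := by
  simpa using div_mem_regularAt (s := s) p (q := 1) (by simp)

/-- Evaluation of a rational function. -/
abbrev ev (s : ℂ) (f : RatFunc ℂ) : ℂ := RatFunc.eval (RingHom.id ℂ) s f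

theorem ev_add {s : ℂ} {f g : RatFunc ℂ} (hf : f ∈ regularAt s) (hg : g ∈ regularAt s) :
    ev s (f + g) = ev s f + ev s g := RatFunc.eval_add _ _ hf hg

theorem ev_mul {s : ℂ} {f g : RatFunc ℂ} (hf : f ∈ regularAt s) (hg : g ∈ regularAt s) :
    ev s (f * g) = ev s f * ev s g := RatFunc.eval_mul _ _ hf hg

theorem ev_algebraMap (s : ℂ) (p : Polynomial ℂ) :
    ev s (algebraMap (Polynomial ℂ) (RatFunc ℂ) p) = p.eval s := by
  simp [ev, RatFunc.eval_algebraMap, Polynomial.eval₂_id]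

theorem ev_neg {s : ℂ} {f : RatFunc ℂ} (hf : f ∈ regularAt s) : ev s (-f) = -ev s f := by
  have h := ev_add hf (neg_mem hf)
  rw [add_neg_cancel] at h
  have h0 : ev s 0 = 0 := RatFunc.eval_zero _ _
  rw [h0] at h
  exact (neg_eq_of_add_eq_zero_right h.symm).symm

/-- Evaluation as a ring homomorphism. -/
def evHom (s : ℂ) : regularAt s →+* ℂ where
  toFun f := ev s f
  map_one' := RatFunc.eval_one _ _
  map_zero' := RatFunc.eval_zero _ _
  map_mul' f g := ev_mul f.2 g.2
  map_add' f g := ev_add f.2 g.2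

theorem ev_div {s : ℂ} (p : Polynomial ℂ) {q : Polynomial ℂ} (hq : q.eval s ≠ 0) :
    ev s (algebraMap (Polynomial ℂ) (RatFunc ℂ) p / algebraMap (Polynomial ℂ) (RatFunc ℂ) q) =
      p.eval s / q.eval s := by
  have hq0 : algebraMap (Polynomial ℂ) (RatFunc ℂ) q ≠ 0 :=
    RatFunc.algebraMap_ne_zero (by rintro rfl; simp at hq)
  rw [eq_div_iff hq, ← ev_algebraMap s q, ← ev_mul (div_mem_regularAt p hq)
    (algebraMap_mem_regularAt s q), div_mul_cancel₀ _ hq0, ev_algebraMap]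

theorem ev_eq_div (s : ℂ) (f : RatFunc ℂ) : ev s f = f.num.eval s / f.denom.eval s := by
  simp [ev, RatFunc.eval, Polynomial.eval₂_id]

theorem star_mem_regularAt {s : ℂ} {f : RatFunc ℂ} (hf : f ∈ regularAt (-star s)) :
    star f ∈ regularAt s := by
  rw [star_ratFunc, ratParaConj_apply]
  refine div_mem_regularAt _ ?_
  rw [polyParaConj_eval]
  exact star_ne_zero.2 hf

theorem ev_star {s : ℂ} {f : RatFunc ℂ} (hf : f ∈ regularAt (-star s)) :
    ev s (star f) = star (ev (-star s) f) := by
  rw [star_ratFunc, ratParaConj_apply, ev_div, polyParaConj_eval, polyParaConj_eval, ev_eq_div,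
    star_div₀]
  rw [polyParaConj_eval]
  exact star_ne_zero.2 hf

/-- The imaginary axis is the fixed set of s ↦ -s*. There para-Hermitian conjugation becomes the
ordinary adjoint of the value, which links algebraic identities for H^H to Hermitian inequalities.
-/
theorem neg_star_I_mul (ω : ℝ) : -star (Complex.I * (ω : ℂ)) = Complex.I * (ω : ℂ) := by
  simp

/-- The zero function has `intDegree` 0 rather than -∞, so cancellation is harmless only when the
bound is nonnegative. -/
theorem intDegree_add_le_of_le {d : ℤ} (hd : 0 ≤ d) {f g : RatFunc ℂ} (hf : f.intDegree ≤ d)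
    (hg : g.intDegree ≤ d) : (f + g).intDegree ≤ d := by
  by_cases h : f + g = 0
  · simpa [h] using hd
  by_cases hg0 : g = 0
  · simpa [hg0] using hf
  exact (RatFunc.intDegree_add_le hg0 h).trans (max_le hf hg)

/-- The ring of proper rational functions. -/
def properRing : Subring (RatFunc ℂ) where
  carrier := {f | f.intDegree ≤ 0}
  one_mem' := by simp
  zero_mem' := by simp
  mul_mem' {f g} hf hg := by
    by_cases h : f = 0
    · simp [h]
    by_cases h' : g = 0
    · simp [h']
    simp only [Set.mem_ofPred_eq] at *
    rw [RatFunc.intDegree_mul h h']; omega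
  add_mem' {f g} hf hg := intDegree_add_le_of_le le_rfl hf hg
  neg_mem' {f} hf := by simpa using hf

theorem mem_properRing {f : RatFunc ℂ} : f ∈ properRing ↔ f.intDegree ≤ 0 := Iff.rfl

theorem mem_properRing_iff {f : RatFunc ℂ} :
    f ∈ properRing ↔ f.num.natDegree ≤ f.denom.natDegree := by
  rw [mem_properRing, RatFunc.intDegree]; omega

theorem C_mem_properRing (c : ℂ) : (RatFunc.C c : RatFunc ℂ) ∈ properRing := by
  simp [mem_properRing]

theorem C_mem_regularAt (s c : ℂ) : (RatFunc.C c : RatFunc ℂ) ∈ regularAt s := by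
  rw [← RatFunc.algebraMap_C]; exact algebraMap_mem_regularAt _ _

theorem div_mem_properRing {p q : Polynomial ℂ} (h : p.natDegree ≤ q.natDegree) :
    algebraMap (Polynomial ℂ) (RatFunc ℂ) p / algebraMap (Polynomial ℂ) (RatFunc ℂ) q
      ∈ properRing := by
  by_cases hp : p = 0
  · simp [hp]
  by_cases hq : q = 0
  · simp [hq]
  rw [mem_properRing, RatFunc.intDegree_div (RatFunc.algebraMap_ne_zero hp)
    (RatFunc.algebraMap_ne_zero hq), RatFunc.intDegree_polynomial, RatFunc.intDegree_polynomial]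
  omega

theorem star_mem_properRing {f : RatFunc ℂ} (hf : f ∈ properRing) : star f ∈ properRing := by
  rw [star_ratFunc, ratParaConj_apply]
  refine div_mem_properRing ?_
  rw [natDegree_polyParaConj, natDegree_polyParaConj]
  exact mem_properRing_iff.1 hf

/-- Proper rational functions without poles on the imaginary axis. -/
def axisRing : Subring (RatFunc ℂ) := properRing ⊓ ⨅ ω : ℝ, regularAt (Complex.I * (ω : ℂ))

/-- Proper rational functions without poles in the closed right half-plane. -/
def stableRing : Subring (RatFunc ℂ) := properRing ⊓ ⨅ s : {s : ℂ // 0 ≤ s.re}, regularAt s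

theorem mem_axisRing {f : RatFunc ℂ} :
    f ∈ axisRing ↔ f ∈ properRing ∧ ∀ ω : ℝ, f ∈ regularAt (Complex.I * (ω : ℂ)) := by
  simp [axisRing, Subring.mem_inf, Subring.mem_iInf]

theorem mem_stableRing {f : RatFunc ℂ} :
    f ∈ stableRing ↔ f ∈ properRing ∧ ∀ s : ℂ, 0 ≤ s.re → f ∈ regularAt s := by
  simp [stableRing, Subring.mem_inf, Subring.mem_iInf]

theorem stableRing_le_axisRing : stableRing ≤ axisRing := by
  intro f hf
  rw [mem_stableRing] at hf
  exact mem_axisRing.2 ⟨hf.1, fun ω => hf.2 _ (by simp)⟩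

theorem star_mem_axisRing {f : RatFunc ℂ} (hf : f ∈ axisRing) : star f ∈ axisRing := by
  rw [mem_axisRing] at *
  refine ⟨star_mem_properRing hf.1, fun ω => star_mem_regularAt ?_⟩
  rw [neg_star_I_mul]; exact hf.2 ω

theorem C_mem_stableRing (c : ℂ) : (RatFunc.C c : RatFunc ℂ) ∈ stableRing :=
  mem_stableRing.2 ⟨C_mem_properRing c, fun s _ => C_mem_regularAt s c⟩

/-! ### Matrices with entries in a subring -/

/-- All entries of `H` lie in `T`. -/
def EntriesIn {a b : Type} (T : Subring (RatFunc ℂ)) (H : TransferMatrix a b) : Prop :=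
  ∀ i j, H i j ∈ T

section EntriesIn

variable {a b c d : Type} {T : Subring (RatFunc ℂ)}

theorem EntriesIn.mul [Fintype b] {H : TransferMatrix a b} {K : TransferMatrix b c}
    (hH : EntriesIn T H) (hK : EntriesIn T K) : EntriesIn T (H * K) := fun i j => by
  rw [Matrix.mul_apply]
  exact sum_mem fun k _ => mul_mem (hH i k) (hK k j)

theorem EntriesIn.add {H K : TransferMatrix a b} (hH : EntriesIn T H) (hK : EntriesIn T K) :
    EntriesIn T (H + K) := fun i j => add_mem (hH i j) (hK i j)

theorem EntriesIn.sub {H K : TransferMatrix a b} (hH : EntriesIn T H) (hK : EntriesIn T K) :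
    EntriesIn T (H - K) := fun i j => sub_mem (hH i j) (hK i j)

theorem EntriesIn.neg {H : TransferMatrix a b} (hH : EntriesIn T H) :
    EntriesIn T (-H) := fun i j => neg_mem (hH i j)

theorem EntriesIn.one [DecidableEq a] : EntriesIn T (1 : TransferMatrix a a) := fun i j => by
  rw [Matrix.one_apply]; split_ifs
  exacts [one_mem _, zero_mem _]

theorem EntriesIn.zero : EntriesIn T (0 : TransferMatrix a b) := fun _ _ => zero_mem _

theorem EntriesIn.fromBlocks {A : TransferMatrix a c} {B : TransferMatrix a d}
    {C : TransferMatrix b c} {D : TransferMatrix b d} (hA : EntriesIn T A) (hB : EntriesIn T B)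
    (hC : EntriesIn T C) (hD : EntriesIn T D) : EntriesIn T (Matrix.fromBlocks A B C D) := by
  rintro (i | i) (j | j)
  exacts [hA i j, hB i j, hC i j, hD i j]

theorem EntriesIn.fromCols {A : TransferMatrix a c} {B : TransferMatrix a d}
    (hA : EntriesIn T A) (hB : EntriesIn T B) : EntriesIn T (Matrix.fromCols A B) := by
  rintro i (j | j)
  exacts [hA i j, hB i j]

theorem EntriesIn.fromRows {A : TransferMatrix a c} {B : TransferMatrix b c}
    (hA : EntriesIn T A) (hB : EntriesIn T B) : EntriesIn T (Matrix.fromRows A B) := by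
  rintro (i | i) j
  exacts [hA i j, hB i j]

theorem EntriesIn.smul {f : RatFunc ℂ} {H : TransferMatrix a b} (hf : f ∈ T)
    (hH : EntriesIn T H) : EntriesIn T (f • H) := fun i j => mul_mem hf (hH i j)

theorem EntriesIn.mono {T' : Subring (RatFunc ℂ)} (h : T ≤ T') {H : TransferMatrix a b}
    (hH : EntriesIn T H) : EntriesIn T' H := fun i j => h (hH i j)

theorem EntriesIn.conjTranspose {H : TransferMatrix a b} (hH : EntriesIn axisRing H) :
    EntriesIn axisRing Hᴴ := fun i j => star_mem_axisRing (hH j i)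

theorem entriesIn_regularAt_axis {H : TransferMatrix a b} (hH : EntriesIn axisRing H) (ω : ℝ) :
    EntriesIn (regularAt (Complex.I * (ω : ℂ))) H := fun i j => (mem_axisRing.1 (hH i j)).2 ω

theorem EntriesIn.const_regularAt (s : ℂ) (M : Matrix a b ℂ) :
    EntriesIn (regularAt s) (const M) := fun _ _ => C_mem_regularAt _ _

theorem EntriesIn.const_stableRing (M : Matrix a b ℂ) :
    EntriesIn stableRing (const M) := fun _ _ => C_mem_stableRing _

theorem EntriesIn.const_axisRing (M : Matrix a b ℂ) : EntriesIn axisRing (const M) :=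
  (EntriesIn.const_stableRing M).mono stableRing_le_axisRing

end EntriesIn

/-! ### Evaluation of transfer matrices at regular points -/

section evalAt

variable {a b c d : Type} {s : ℂ}

theorem evalAt_apply (H : TransferMatrix a b) (i : a) (j : b) :
    evalAt H s i j = ev s (H i j) := rfl

theorem evalAt_mul [Fintype b] {H : TransferMatrix a b} {K : TransferMatrix b c}
    (hH : EntriesIn (regularAt s) H) (hK : EntriesIn (regularAt s) K) :
    evalAt (H * K) s = evalAt H s * evalAt K s := by
  ext i j
  rw [evalAt_apply, Matrix.mul_apply, Matrix.mul_apply]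
  have h := map_sum (evHom s) (fun k => (⟨H i k, hH i k⟩ * ⟨K k j, hK k j⟩ : regularAt s))
    Finset.univ
  refine (congrArg (ev s) ?_).trans (h.trans (Finset.sum_congr rfl fun k _ => map_mul _ _ _))
  push_cast
  rfl

theorem evalAt_add {H K : TransferMatrix a b}
    (hH : EntriesIn (regularAt s) H) (hK : EntriesIn (regularAt s) K) :
    evalAt (H + K) s = evalAt H s + evalAt K s := by
  ext i j; exact ev_add (hH i j) (hK i j)

theorem evalAt_neg {H : TransferMatrix a b} (hH : EntriesIn (regularAt s) H) :
    evalAt (-H) s = -evalAt H s := by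
  ext i j; exact ev_neg (hH i j)

theorem evalAt_sub {H K : TransferMatrix a b}
    (hH : EntriesIn (regularAt s) H) (hK : EntriesIn (regularAt s) K) :
    evalAt (H - K) s = evalAt H s - evalAt K s := by
  rw [sub_eq_add_neg, evalAt_add hH hK.neg, evalAt_neg hK, sub_eq_add_neg]

theorem evalAt_const (M : Matrix a b ℂ) : evalAt (const M) s = M := by
  ext i j; simp [evalAt, const]

theorem evalAt_one [DecidableEq a] : evalAt (1 : TransferMatrix a a) s = 1 := by
  ext i j
  simp only [evalAt, Matrix.map_apply, Matrix.one_apply]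
  split_ifs <;> simp

theorem evalAt_fromCols (A : TransferMatrix a c) (B : TransferMatrix a d) :
    evalAt (fromCols A B) s = fromCols (evalAt A s) (evalAt B s) := by
  ext i (j | j) <;> rfl

theorem freq_conjTranspose {H : TransferMatrix a b} {ω : ℝ}
    (hH : EntriesIn (regularAt (Complex.I * (ω : ℂ))) H) : freq Hᴴ ω = (freq H ω)ᴴ := by
  ext i j
  have h := hH j i
  rw [← neg_star_I_mul] at h
  have h2 := ev_star h
  rw [neg_star_I_mul] at h2
  exact h2

end evalAt

theorem isProper_iff {a b : Type} {H : TransferMatrix a b} :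
    IsProper H ↔ EntriesIn properRing H := by
  simp only [IsProper, EntriesIn, mem_properRing_iff]

/-- A rational matrix with finitely many entries has finitely many poles, so the rightmost one
supplies the margin τ. Stability is thereby reduced to regularity on the closed right half-plane. -/
theorem isStable_iff {a b : Type} [Finite a] [Finite b] {H : TransferMatrix a b} :
    IsStable H ↔ ∀ s : ℂ, 0 ≤ s.re → EntriesIn (regularAt s) H := by
  have key : ∀ s, ¬ IsPole H s ↔ EntriesIn (regularAt s) H := by
    intro s; simp [IsPole, EntriesIn, mem_regularAt]
  constructor
  · intro h s hs
    rw [← key]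
    intro hp
    exact absurd (h.1 s hp) (not_lt.2 hs)
  · intro h
    have h1 : ∀ s : ℂ, IsPole H s → s.re < 0 := by
      intro s hp
      by_contra hs
      exact (key s).2 (h s (not_lt.1 hs)) hp
    refine ⟨h1, ?_⟩
    have hfin : {s | IsPole H s}.Finite := by
      have : {s | IsPole H s} = ⋃ i, ⋃ j, {s | (H i j).denom.IsRoot s} := by
        ext s; simp [IsPole]
      rw [this]
      exact Set.finite_iUnion fun i => Set.finite_iUnion fun j =>
        Polynomial.finite_setOfPred_isRoot (RatFunc.denom_ne_zero _)
    rcases Set.eq_empty_or_nonempty {s | IsPole H s} with he | hne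
    · exact ⟨1, one_pos, fun s _ hp => by simpa [he] using (show s ∈ {s | IsPole H s} from hp)⟩
    · obtain ⟨s0, hs0, hmax⟩ := Set.exists_max_image _ Complex.re hfin hne
      refine ⟨-s0.re, by linarith [h1 s0 hs0], fun s hs hp => ?_⟩
      linarith [hmax s hp]

theorem isProper_and_isStable_iff {a b : Type} [Finite a] [Finite b] {H : TransferMatrix a b} :
    IsProper H ∧ IsStable H ↔ EntriesIn stableRing H := by
  rw [isProper_iff, isStable_iff]
  simp only [EntriesIn, mem_stableRing]
  exact ⟨fun h i j => ⟨h.1 i j, fun s hs => h.2 s hs i j⟩,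
    fun h => ⟨fun i j => (h i j).1, fun s hs i j => (h i j).2 s hs⟩⟩

/-! ### State-space transfer functions -/

section transfer

variable {x a b : Type} [Fintype x] [DecidableEq x]

/-- The resolvent `(sI - A)⁻¹` as a transfer matrix. -/
def resolventMatrix (A : Matrix x x ℂ) : TransferMatrix x x :=
  ((RatFunc.X : RatFunc ℂ) • (1 : TransferMatrix x x) - const A)⁻¹

theorem charmatrix_map_algebraMap (A : Matrix x x ℂ) :
    A.charmatrix.map (algebraMap (Polynomial ℂ) (RatFunc ℂ)) =
      (RatFunc.X : RatFunc ℂ) • (1 : TransferMatrix x x) - const A := by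
  ext i j
  by_cases h : i = j
  · subst h; simp [const]
  · simp [const, h]

theorem det_X_smul_one_sub_const (A : Matrix x x ℂ) :
    ((RatFunc.X : RatFunc ℂ) • (1 : TransferMatrix x x) - const A).det =
      algebraMap (Polynomial ℂ) (RatFunc ℂ) A.charpoly := by
  rw [← charmatrix_map_algebraMap, Matrix.charpoly, RingHom.map_det]; rfl

theorem isUnit_det_X_smul_one_sub_const (A : Matrix x x ℂ) :
    IsUnit ((RatFunc.X : RatFunc ℂ) • (1 : TransferMatrix x x) - const A).det := by
  rw [det_X_smul_one_sub_const, isUnit_iff_ne_zero]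
  exact RatFunc.algebraMap_ne_zero A.charpoly_monic.ne_zero

theorem mul_resolventMatrix (A : Matrix x x ℂ) :
    ((RatFunc.X : RatFunc ℂ) • (1 : TransferMatrix x x) - const A) * resolventMatrix A = 1 :=
  Matrix.mul_nonsing_inv _ (isUnit_det_X_smul_one_sub_const A)

theorem resolventMatrix_mul (A : Matrix x x ℂ) :
    resolventMatrix A * ((RatFunc.X : RatFunc ℂ) • (1 : TransferMatrix x x) - const A) = 1 :=
  Matrix.nonsing_inv_mul _ (isUnit_det_X_smul_one_sub_const A)

theorem transfer_eq (A : Matrix x x ℂ) (B : Matrix x b ℂ) (C : Matrix a x ℂ) (D : Matrix a b ℂ) :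
    transfer A B C D = const C * resolventMatrix A * const B + const D := rfl

/-- By Cramer's rule the resolvent is the adjugate divided by the characteristic polynomial, so its
poles are eigenvalues of A. -/
theorem resolventMatrix_regularAt {A : Matrix x x ℂ} {s : ℂ}
    (hs : (s • (1 : Matrix x x ℂ) - A).det ≠ 0) : EntriesIn (regularAt s) (resolventMatrix A) := by
  intro i j
  rw [resolventMatrix, Matrix.inv_def, det_X_smul_one_sub_const, ← charmatrix_map_algebraMap]
  have h : (A.charmatrix.map (algebraMap (Polynomial ℂ) (RatFunc ℂ))).adjugate =
      A.charmatrix.adjugate.map (algebraMap (Polynomial ℂ) (RatFunc ℂ)) :=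
    (RingHom.map_adjugate (algebraMap (Polynomial ℂ) (RatFunc ℂ)) _).symm
  rw [h, Matrix.smul_apply, Matrix.map_apply, Ring.inverse_eq_inv', smul_eq_mul, mul_comm,
    ← div_eq_mul_inv]
  refine div_mem_regularAt _ ?_
  rwa [Matrix.eval_charpoly, Matrix.scalar_apply, ← Matrix.smul_one_eq_diagonal]

theorem X_mem_regularAt (s : ℂ) : (RatFunc.X : RatFunc ℂ) ∈ regularAt s := by
  rw [← RatFunc.algebraMap_X]; exact algebraMap_mem_regularAt _ _

theorem evalAt_resolventMatrix {A : Matrix x x ℂ} {s : ℂ}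
    (hs : (s • (1 : Matrix x x ℂ) - A).det ≠ 0) :
    (s • (1 : Matrix x x ℂ) - A) * evalAt (resolventMatrix A) s = 1 := by
  have hX : EntriesIn (regularAt s) ((RatFunc.X : RatFunc ℂ) • (1 : TransferMatrix x x)) :=
    EntriesIn.one.smul (X_mem_regularAt s)
  have h := congrArg (fun H => evalAt H s) (mul_resolventMatrix A)
  rw [evalAt_mul (hX.sub (EntriesIn.const_regularAt s A)) (resolventMatrix_regularAt hs),
    evalAt_sub hX (EntriesIn.const_regularAt s A), evalAt_const, evalAt_one] at h
  convert h using 3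
  ext i j
  by_cases hij : i = j
  · subst hij; simp [evalAt]
  · simp [evalAt, hij]

theorem transfer_regularAt {A : Matrix x x ℂ} {s : ℂ}
    (hs : (s • (1 : Matrix x x ℂ) - A).det ≠ 0) (B : Matrix x b ℂ) (C : Matrix a x ℂ)
    (D : Matrix a b ℂ) : EntriesIn (regularAt s) (transfer A B C D) :=
  (((EntriesIn.const_regularAt s C).mul (resolventMatrix_regularAt hs)).mul
    (EntriesIn.const_regularAt s B)).add (EntriesIn.const_regularAt s D)

theorem evalAt_transfer {A : Matrix x x ℂ} {s : ℂ}
    (hs : (s • (1 : Matrix x x ℂ) - A).det ≠ 0) (B : Matrix x b ℂ) (C : Matrix a x ℂ)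
    (D : Matrix a b ℂ) :
    evalAt (transfer A B C D) s = C * (s • (1 : Matrix x x ℂ) - A)⁻¹ * B + D := by
  have hr := resolventMatrix_regularAt hs
  have hC := EntriesIn.const_regularAt s C
  have hB := EntriesIn.const_regularAt s B
  have hD := EntriesIn.const_regularAt s D
  rw [transfer_eq, evalAt_add ((hC.mul hr).mul hB) hD, evalAt_mul (hC.mul hr) hB,
    evalAt_mul hC hr, evalAt_const, evalAt_const, evalAt_const,
    Matrix.inv_eq_right_inv (evalAt_resolventMatrix hs)]

/-- Choose an entry of the resolvent R of largest degree d. If d > 0, the identity sR = I + AR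
equates a function of degree d + 1 with one of degree at most d. -/
theorem resolventMatrix_proper (A : Matrix x x ℂ) :
    EntriesIn properRing (resolventMatrix A) := by
  by_contra hcon
  simp only [EntriesIn, mem_properRing, not_forall, not_le] at hcon
  obtain ⟨i0, j0, h0⟩ := hcon
  obtain ⟨⟨i, j⟩, -, hmax⟩ := Finset.exists_max_image (Finset.univ : Finset (x × x))
    (fun ij => (resolventMatrix A ij.1 ij.2).intDegree) ⟨(i0, j0), Finset.mem_univ _⟩
  set d := (resolventMatrix A i j).intDegree with hd
  have hmax' : ∀ k l, (resolventMatrix A k l).intDegree ≤ d :=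
    fun k l => hmax (k, l) (Finset.mem_univ _)
  have hdpos : 0 < d := h0.trans_le (hmax' i0 j0)
  have hne : resolventMatrix A i j ≠ 0 := by
    intro h; rw [hd, h] at hdpos; simp at hdpos
  have hmul := mul_resolventMatrix A
  rw [sub_mul, sub_eq_iff_eq_add, smul_mul_assoc, one_mul] at hmul
  have hij := congrFun (congrFun hmul i) j
  rw [Matrix.smul_apply, smul_eq_mul, Matrix.add_apply, Matrix.mul_apply] at hij
  have hlhs : (RatFunc.X * resolventMatrix A i j : RatFunc ℂ).intDegree = 1 + d := by
    rw [RatFunc.intDegree_mul RatFunc.X_ne_zero hne, RatFunc.intDegree_X]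
  have hrhs : ((1 : TransferMatrix x x) i j
      + ∑ k, const A i k * resolventMatrix A k j).intDegree ≤ d := by
    refine intDegree_add_le_of_le hdpos.le ?_ ?_
    · rw [Matrix.one_apply]; split_ifs <;> simp [hdpos.le]
    · refine Finset.sum_induction _ (fun f : RatFunc ℂ => f.intDegree ≤ d)
        (fun f g hf hg => intDegree_add_le_of_le hdpos.le hf hg) (by simp [hdpos.le]) ?_
      intro k _
      by_cases h1 : const A i k = 0
      · simp [h1, hdpos.le]
      by_cases h2 : resolventMatrix A k j = 0
      · simp [h2, hdpos.le]
      rw [RatFunc.intDegree_mul h1 h2]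
      have : (const A i k).intDegree = 0 := RatFunc.intDegree_C _
      rw [this, zero_add]
      exact hmax' k j
  rw [← hij, hlhs] at hrhs
  omega

theorem transfer_proper (A : Matrix x x ℂ) (B : Matrix x b ℂ) (C : Matrix a x ℂ)
    (D : Matrix a b ℂ) : EntriesIn properRing (transfer A B C D) := by
  have h : ∀ {c d : Type} (M : Matrix c d ℂ), EntriesIn properRing (const M) :=
    fun M i j => C_mem_properRing _
  exact (((h C).mul (resolventMatrix_proper A)).mul (h B)).add (h D)

end transfer

/-! ### Limits along the closed imaginary axis -/

open Filter Topology

/-- The filters which describe the points of `ℝ ∪ {±∞}`. -/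
def IsAxisFilter (l : Filter ℝ) : Prop := (∃ ω, l = pure ω) ∨ l = cocompact ℝ

theorem IsAxisFilter.neBot {l : Filter ℝ} (hl : IsAxisFilter l) : l.NeBot := by
  rcases hl with ⟨ω, rfl⟩ | rfl <;> infer_instance

theorem tendsto_eval_div_pow {p : Polynomial ℂ} {n : ℕ} (hp : p.natDegree ≤ n) :
    Tendsto (fun z : ℂ => p.eval z / z ^ n) (Bornology.cobounded ℂ) (𝓝 (p.coeff n)) := by
  have hterm : ∀ i ∈ Finset.range (n + 1),
      Tendsto (fun z : ℂ => p.coeff i * (z⁻¹) ^ (n - i)) (Bornology.cobounded ℂ)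
        (𝓝 (if i = n then p.coeff i else 0)) := by
    intro i hi
    have hi' : i ≤ n := Nat.lt_succ_iff.1 (Finset.mem_range.1 hi)
    have h0 : Tendsto (fun z : ℂ => (z⁻¹) ^ (n - i)) (Bornology.cobounded ℂ)
        (𝓝 (0 ^ (n - i))) := (tendsto_inv₀_cobounded (α := ℂ)).pow _
    have h1 := h0.const_mul (p.coeff i)
    rcases eq_or_ne i n with rfl | hne
    · simp
    · rw [zero_pow (Nat.sub_ne_zero_of_lt (lt_of_le_of_ne hi' hne)), mul_zero] at h1
      simpa [hne] using h1
  have hsum := tendsto_finsetSum _ hterm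
  rw [Finset.sum_ite_eq' (Finset.range (n + 1)) n, if_pos (Finset.self_mem_range_succ n)] at hsum
  refine hsum.congr' ?_
  have hne : ∀ᶠ z : ℂ in Bornology.cobounded ℂ, z ≠ 0 :=
    Bornology.eventually_ne_cobounded 0
  filter_upwards [hne] with z hz
  rw [Polynomial.eval_eq_sum_range' (Nat.lt_succ_of_le hp), Finset.sum_div]
  refine Finset.sum_congr rfl fun i hi => ?_
  have hi' : i ≤ n := Nat.lt_succ_iff.1 (Finset.mem_range.1 hi)
  rw [inv_pow, mul_div_assoc, ← pow_sub_mul_pow z hi']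
  field_simp

theorem tendsto_I_mul_cobounded :
    Tendsto (fun ω : ℝ => Complex.I * (ω : ℂ)) (cocompact ℝ) (Bornology.cobounded ℂ) := by
  rw [← tendsto_norm_atTop_iff_cobounded]
  refine (tendsto_norm_cocompact_atTop (E := ℝ)).congr fun ω => ?_
  simp

/-- Numerator and denominator are divided by (iω)^deg of the denominator. The denominator is monic,
so its quotient tends to 1 and the limit is the coefficient of the numerator in that degree. -/
theorem tendsto_ev_cocompact {f : RatFunc ℂ} (hf : f ∈ properRing) :
    Tendsto (fun ω : ℝ => ev (Complex.I * (ω : ℂ)) f) (cocompact ℝ)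
      (𝓝 (f.num.coeff f.denom.natDegree)) := by
  have h1 := (tendsto_eval_div_pow (mem_properRing_iff.1 hf)).comp tendsto_I_mul_cobounded
  have h2 := (tendsto_eval_div_pow (le_refl f.denom.natDegree)).comp tendsto_I_mul_cobounded
  have hlc : f.denom.coeff f.denom.natDegree = 1 := f.monic_denom
  rw [hlc] at h2
  have h3 := h1.div h2 one_ne_zero
  rw [div_one] at h3
  refine h3.congr' ?_
  filter_upwards [tendsto_I_mul_cobounded.eventually (Bornology.eventually_ne_cobounded 0)] with ω hω
  simp only [Pi.div_apply, Function.comp, ev_eq_div]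
  rw [div_div_div_cancel_right₀ (pow_ne_zero _ hω)]

theorem exists_tendsto_ev {l : Filter ℝ} (hl : IsAxisFilter l) {f : RatFunc ℂ}
    (hf : f ∈ properRing) :
    ∃ v, Tendsto (fun ω : ℝ => ev (Complex.I * (ω : ℂ)) f) l (𝓝 v) := by
  rcases hl with ⟨ω, rfl⟩ | rfl
  · exact ⟨_, tendsto_pure_nhds _ _⟩
  · exact ⟨_, tendsto_ev_cocompact hf⟩

theorem exists_tendsto_freq {a b : Type} {l : Filter ℝ} (hl : IsAxisFilter l)
    {H : TransferMatrix a b} (hH : EntriesIn properRing H) :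
    ∃ V, Tendsto (freq H) l (𝓝 V) := by
  choose v hv using fun i j => exists_tendsto_ev hl (hH i j)
  exact ⟨Matrix.of v, tendsto_pi_nhds.2 fun i => tendsto_pi_nhds.2 fun j => hv i j⟩

theorem EntriesIn.proper {a b : Type} {H : TransferMatrix a b} (hH : EntriesIn axisRing H) :
    EntriesIn properRing H := fun i j => (mem_axisRing.1 (hH i j)).1

section tendsto

variable {a b c : Type} {l : Filter ℝ}

theorem tendsto_freq_pure {H : TransferMatrix a b} {ω : ℝ} {V : Matrix a b ℂ} :
    Tendsto (freq H) (pure ω) (𝓝 V) ↔ freq H ω = V :=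
  ⟨fun h => tendsto_nhds_unique (tendsto_pure_nhds _ _) h, fun h => h ▸ tendsto_pure_nhds _ _⟩

theorem freq_mul [Fintype b] {H : TransferMatrix a b} {K : TransferMatrix b c}
    (hH : EntriesIn axisRing H) (hK : EntriesIn axisRing K) (ω : ℝ) :
    freq (H * K) ω = freq H ω * freq K ω :=
  evalAt_mul (entriesIn_regularAt_axis hH ω) (entriesIn_regularAt_axis hK ω)

theorem freq_add {H K : TransferMatrix a b}
    (hH : EntriesIn axisRing H) (hK : EntriesIn axisRing K) (ω : ℝ) :
    freq (H + K) ω = freq H ω + freq K ω :=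
  evalAt_add (entriesIn_regularAt_axis hH ω) (entriesIn_regularAt_axis hK ω)

theorem freq_sub {H K : TransferMatrix a b}
    (hH : EntriesIn axisRing H) (hK : EntriesIn axisRing K) (ω : ℝ) :
    freq (H - K) ω = freq H ω - freq K ω :=
  evalAt_sub (entriesIn_regularAt_axis hH ω) (entriesIn_regularAt_axis hK ω)

theorem freq_one [DecidableEq a] (ω : ℝ) : freq (1 : TransferMatrix a a) ω = 1 := evalAt_one

theorem freq_const (M : Matrix a b ℂ) (ω : ℝ) : freq (const M) ω = M := evalAt_const M

theorem freq_conjTranspose' {H : TransferMatrix a b} (hH : EntriesIn axisRing H) (ω : ℝ) :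
    freq Hᴴ ω = (freq H ω)ᴴ := freq_conjTranspose (entriesIn_regularAt_axis hH ω)

theorem tendsto_freq_conjTranspose {H : TransferMatrix a b} (hH : EntriesIn axisRing H)
    {V : Matrix a b ℂ} (h : Tendsto (freq H) l (𝓝 V)) :
    Tendsto (freq Hᴴ) l (𝓝 Vᴴ) := by
  rw [show freq Hᴴ = fun ω => (freq H ω)ᴴ from funext (freq_conjTranspose' hH)]
  exact (continuous_id.matrix_conjTranspose.tendsto V).comp h

theorem tendsto_matrix_mul [Fintype b] {f : ℝ → Matrix a b ℂ} {g : ℝ → Matrix b c ℂ}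
    {V : Matrix a b ℂ} {W : Matrix b c ℂ} (hf : Tendsto f l (𝓝 V)) (hg : Tendsto g l (𝓝 W)) :
    Tendsto (fun ω => f ω * g ω) l (𝓝 (V * W)) := by
  refine tendsto_pi_nhds.2 fun i => tendsto_pi_nhds.2 fun j => ?_
  simp only [Matrix.mul_apply]
  exact tendsto_finsetSum _ fun k _ =>
    (tendsto_pi_nhds.1 (tendsto_pi_nhds.1 hf i) k).mul (tendsto_pi_nhds.1 (tendsto_pi_nhds.1 hg k) j)

theorem tendsto_freq_mul [Fintype b] {H : TransferMatrix a b} {K : TransferMatrix b c}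
    (hH : EntriesIn axisRing H) (hK : EntriesIn axisRing K)
    {V : Matrix a b ℂ} {W : Matrix b c ℂ} (h : Tendsto (freq H) l (𝓝 V))
    (k : Tendsto (freq K) l (𝓝 W)) : Tendsto (freq (H * K)) l (𝓝 (V * W)) := by
  rw [show freq (H * K) = fun ω => freq H ω * freq K ω from funext (freq_mul hH hK)]
  exact tendsto_matrix_mul h k

/-- This puts finite frequencies (principal filters) and the point at infinity on the same footing:
later arguments are made once, about limits along an axis filter. -/
theorem onClosedAxis_iff {H : TransferMatrix a b} (hH : EntriesIn properRing H)
    {P : Matrix a b ℂ → Prop} :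
    OnClosedAxis H P ↔ ∀ l, IsAxisFilter l → ∀ V, Tendsto (freq H) l (𝓝 V) → P V := by
  constructor
  · rintro ⟨h1, L, hL, hPL⟩ l (⟨ω, rfl⟩ | rfl) V hV
    · rw [← tendsto_freq_pure.1 hV]; exact h1 ω
    · rw [tendsto_nhds_unique hV hL]; exact hPL
  · intro h
    refine ⟨fun ω => h _ (Or.inl ⟨ω, rfl⟩) _ (tendsto_pure_nhds _ _), ?_⟩
    obtain ⟨L, hL⟩ := exists_tendsto_freq (Or.inr rfl) hH
    exact ⟨L, hL, h _ (Or.inr rfl) L hL⟩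

end tendsto

/-! ### The channel is paraunitary -/

section const

variable {a b c : Type}

theorem const_mul [Fintype b] (M : Matrix a b ℂ) (N : Matrix b c ℂ) :
    const (M * N) = const M * const N := Matrix.map_mul

theorem const_add (M N : Matrix a b ℂ) : const (M + N) = const M + const N :=
  Matrix.map_add _ (map_add _) M N

theorem const_neg (M : Matrix a b ℂ) : const (-M) = -const M := by
  ext i j; simp [const]

theorem const_one [DecidableEq a] : const (1 : Matrix a a ℂ) = 1 :=
  Matrix.map_one _ (map_zero _) (map_one _)

theorem const_conjTranspose (M : Matrix a b ℂ) : (const M)ᴴ = const Mᴴ := by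
  ext i j
  simp only [const, conjTranspose_apply, map_apply, star_ratFunc_C]

end const

/-- Here C = -DB†, so G = D(I - B†rB) with r the resolvent. The Lyapunov equation reads BB† = (s -
A) + (-s - A†), whence r BB† r^H = r + r^H, and the quadratic term of (I - B†rB)(I - B†rB)^H cancels
the linear ones. -/
theorem transfer_mul_conjTranspose {x a b : Type} [Fintype x] [DecidableEq x] [Fintype a]
    [DecidableEq a] [Fintype b] [DecidableEq b] {A : Matrix x x ℂ} {B : Matrix x b ℂ}
    {C : Matrix a x ℂ} {D : Matrix a b ℂ} (hA : A + Aᴴ + B * Bᴴ = 0) (hB : B = -(Cᴴ * D))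
    (hD : D * Dᴴ = 1) : transfer A B C D * (transfer A B C D)ᴴ = 1 := by
  have hC : C = -(D * Bᴴ) := by
    rw [hB, conjTranspose_neg, conjTranspose_mul, conjTranspose_conjTranspose, Matrix.mul_neg,
      neg_neg, ← Matrix.mul_assoc, hD, Matrix.one_mul]
  set X1 : TransferMatrix x x := (RatFunc.X : RatFunc ℂ) • (1 : TransferMatrix x x) with hX1
  have hX1H : X1ᴴ = -X1 := by
    rw [hX1, conjTranspose_smul, conjTranspose_one, star_ratFunc_X, neg_smul]
  set r := resolventMatrix A with hr
  have h1 : r * (X1 - const A) = 1 := resolventMatrix_mul A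
  have h2 : (-X1 - const Aᴴ) * rᴴ = 1 := by
    have := congrArg conjTranspose h1
    rwa [conjTranspose_mul, conjTranspose_sub, hX1H, const_conjTranspose,
      conjTranspose_one] at this
  have hBB : const B * const Bᴴ = (X1 - const A) + (-X1 - const Aᴴ) := by
    rw [← const_mul, show B * Bᴴ = -(A + Aᴴ) from (neg_eq_of_add_eq_zero_right hA).symm, const_neg,
      const_add]
    abel
  have h3 : r * (const B * const Bᴴ) * rᴴ = rᴴ + r := by
    rw [hBB, Matrix.mul_add, Matrix.add_mul, h1, Matrix.one_mul, Matrix.mul_assoc, h2,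
      Matrix.mul_one]
  have hG : transfer A B C D = const D * (1 - const Bᴴ * r * const B) := by
    rw [transfer_eq, ← hr, hC, const_neg, const_mul]
    simp only [Matrix.mul_add, Matrix.add_mul, Matrix.mul_sub, Matrix.sub_mul, Matrix.mul_neg,
      Matrix.neg_mul, Matrix.mul_one, Matrix.one_mul, Matrix.mul_assoc]
    abel
  have hGH : (transfer A B C D)ᴴ = (1 - const Bᴴ * rᴴ * const B) * const Dᴴ := by
    rw [hG, conjTranspose_mul, conjTranspose_sub, conjTranspose_mul, conjTranspose_mul,
      conjTranspose_one, const_conjTranspose, const_conjTranspose, const_conjTranspose,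
      conjTranspose_conjTranspose, Matrix.mul_assoc]
  have h4 : (1 - const Bᴴ * r * const B) * (1 - const Bᴴ * rᴴ * const B) = 1 := by
    have : (1 - const Bᴴ * r * const B) * (1 - const Bᴴ * rᴴ * const B) =
        1 - const Bᴴ * r * const B - const Bᴴ * rᴴ * const B
          + const Bᴴ * (r * (const B * const Bᴴ) * rᴴ) * const B := by
      simp only [Matrix.mul_add, Matrix.add_mul, Matrix.mul_sub, Matrix.sub_mul, Matrix.mul_neg,
      Matrix.neg_mul, Matrix.mul_one, Matrix.one_mul, Matrix.mul_assoc]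
      abel
    rw [this, h3]
    simp only [Matrix.mul_add, Matrix.add_mul, Matrix.mul_sub, Matrix.sub_mul, Matrix.mul_neg,
      Matrix.neg_mul, Matrix.mul_one, Matrix.one_mul, Matrix.mul_assoc]
    abel
  rw [hGH, hG]
  calc const D * (1 - const Bᴴ * r * const B) * ((1 - const Bᴴ * rᴴ * const B) * const Dᴴ)
      = const D * ((1 - const Bᴴ * r * const B) * (1 - const Bᴴ * rᴴ * const B)) * const Dᴴ := by
        simp only [Matrix.mul_assoc]
    _ = 1 := by rw [h4, Matrix.mul_one, ← const_mul, hD, const_one]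

namespace Channel

variable {n nw ny nd k : ℕ} (S : Channel n nw ny nd k)

theorem G_mul_conjTranspose : S.G * S.Gᴴ = 1 :=
  transfer_mul_conjTranspose S.lyapunov S.coupling S.unitary_right

theorem G11_mul_add_G12_mul : S.G11 * S.G11ᴴ + S.G12 * S.G12ᴴ = 1 := by
  have h := S.G_mul_conjTranspose
  have h' := congrArg toBlocks₁₁ h
  rw [← fromBlocks_toBlocks S.G, fromBlocks_conjTranspose, fromBlocks_multiply,
    toBlocks_fromBlocks₁₁, ← fromBlocks_one, toBlocks_fromBlocks₁₁] at h'
  exact h'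

theorem blockPSD_eq (H11 : TransferMatrix (Fin n) (Fin ny)) :
    S.blockPSD H11 = H11 * S.Psi * H11ᴴ - H11 * (S.G11 * const (1 + S.Suᵀ))
      - const (1 + S.Suᵀ) * S.G11ᴴ * H11ᴴ + const (S.Suᵀ + (2 : ℂ) • 1) := by
  rw [blockPSD, Phi, fromCols_mul_fromBlocks, fromCols_mul_fromRows]
  simp only [paraConj_eq_conjTranspose]
  simp only [Matrix.mul_add, Matrix.add_mul, Matrix.mul_sub, Matrix.sub_mul, Matrix.mul_neg,
      Matrix.neg_mul, Matrix.mul_one, Matrix.one_mul, Matrix.mul_assoc]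
  abel

/-- For an admissible filter the error power spectrum density depends on `H₁₁` only. -/
theorem errorPSD_eq_blockPSD {nz nzh : ℕ}
    (H : TransferMatrix (Fin n ⊕ Fin nzh) (Fin ny ⊕ Fin nz)) (hH : H * paraConj H = 1) :
    S.errorPSD H = S.blockPSD H.toBlocks₁₁ := by
  have hrow : H.toBlocks₁₁ * H.toBlocks₁₁ᴴ + H.toBlocks₁₂ * H.toBlocks₁₂ᴴ = 1 := by
    have h' := congrArg toBlocks₁₁ hH
    rw [paraConj_eq_conjTranspose, ← fromBlocks_toBlocks H, fromBlocks_conjTranspose,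
      fromBlocks_multiply, toBlocks_fromBlocks₁₁, ← fromBlocks_one, toBlocks_fromBlocks₁₁] at h'
    simpa using h'
  have hG := S.G11_mul_add_G12_mul
  rw [blockPSD_eq, errorPSD, Psi]
  simp only [paraConj_eq_conjTranspose, conjTranspose_sub, conjTranspose_mul, conjTranspose_one]
  set K := H.toBlocks₁₁
  set L := H.toBlocks₁₂
  have e1 : const (S.Suᵀ + (2 : ℂ) • 1) = 1 + 1 + const S.Suᵀ := by
    rw [two_smul, const_add, const_add, const_one]; abel
  -- Paraunitarity of the filter eliminates its noise block, and that of the channel inserts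
  -- G₁₁G₁₁^H + G₁₂G₁₂^H. The vacuum contributions of u and w passing through K then cancel, leaving
  -- only the thermal part Ψ.
  have e2 : L * Lᴴ = 1 - K * (S.G11 * S.G11ᴴ + S.G12 * S.G12ᴴ) * Kᴴ := by
    rw [hG, Matrix.mul_one, ← hrow]; abel
  rw [e1, e2]
  simp only [const_add, const_one]
  simp only [Matrix.mul_add, Matrix.add_mul, Matrix.mul_sub, Matrix.sub_mul, Matrix.mul_neg,
      Matrix.neg_mul, Matrix.mul_one, Matrix.one_mul, Matrix.mul_assoc]
  abel

end Channel

/-! ### From the filter inequality to suboptimal transfer functions -/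

/-! ### Limits of semidefinite matrices, Lyapunov and bounded real inequalities -/

section PosDef

variable {a b c : Type} [Fintype a] [Fintype b] [Fintype c]

theorem posSemidef_of_tendsto {l : Filter ℝ} [l.NeBot] {f : ℝ → Matrix a a ℂ} {V : Matrix a a ℂ}
    (hf : Tendsto f l (𝓝 V)) (h : ∀ᶠ ω in l, (f ω).PosSemidef) : V.PosSemidef := by
  refine PosSemidef.of_dotProduct_mulVec_nonneg ?_ fun x => ?_
  · have h1 : Tendsto (fun ω => (f ω)ᴴ) l (𝓝 Vᴴ) :=
      (continuous_id.matrix_conjTranspose.tendsto V).comp hf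
    exact tendsto_nhds_unique (h1.congr' (h.mono fun ω hω => hω.1)) hf
  · have h1 : Continuous fun M : Matrix a a ℂ => star x ⬝ᵥ (M *ᵥ x) := by fun_prop
    exact ge_of_tendsto ((h1.tendsto V).comp hf) (h.mono fun ω hω => hω.dotProduct_mulVec_nonneg x)

/-- If Av = sv, then v†(A†X + XA)v = 2 Re(s) v†Xv, which must be negative while v†Xv is positive. -/
theorem det_ne_zero_of_lyapunov [DecidableEq a] {A X : Matrix a a ℂ} (hX : X.PosDef)
    (h : (-(Aᴴ * X + X * A)).PosDef) {s : ℂ} (hs : 0 ≤ s.re) :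
    (s • (1 : Matrix a a ℂ) - A).det ≠ 0 := by
  intro hdet
  obtain ⟨v, hv, hAv⟩ := Matrix.exists_mulVec_eq_zero_iff.2 hdet
  have hAv' : A *ᵥ v = s • v := by
    rw [sub_mulVec, smul_mulVec, one_mulVec, sub_eq_zero] at hAv
    exact hAv.symm
  have h1 := h.dotProduct_mulVec_pos hv
  have h2 := hX.dotProduct_mulVec_pos hv
  have e1 : star v ⬝ᵥ (Aᴴ * X) *ᵥ v = star s * (star v ⬝ᵥ X *ᵥ v) := by
    rw [← mulVec_mulVec, dotProduct_mulVec, ← star_mulVec, hAv', star_smul, smul_dotProduct,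
      smul_eq_mul]
  have e2 : star v ⬝ᵥ (X * A) *ᵥ v = s * (star v ⬝ᵥ X *ᵥ v) := by
    rw [← mulVec_mulVec, hAv', mulVec_smul, dotProduct_smul, smul_eq_mul]
  rw [neg_mulVec, add_mulVec, dotProduct_neg, dotProduct_add, e1, e2, ← add_mul] at h1
  have e3 : star s + s = ((2 * s.re : ℝ) : ℂ) := by
    rw [add_comm]; exact Complex.add_conj s
  rw [e3, neg_pos] at h1
  have e4 : (0 : ℂ) ≤ ((2 * s.re : ℝ) : ℂ) := by
    rw [Complex.zero_le_real]; positivity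
  exact (mul_nonneg e4 h2.le).not_gt h1

/-- The elementary direction of the bounded real lemma at a single frequency. -/
theorem bounded_real_at [DecidableEq a] [DecidableEq b] [DecidableEq c] {A X : Matrix a a ℂ}
    {B : Matrix a b ℂ} {C : Matrix c a ℂ} {D : Matrix c b ℂ} {T : Matrix a b ℂ} {W : Matrix c b ℂ}
    {g s : ℂ}
    (h : (-(blocks3 (Aᴴ * X + X * A) (X * B) Cᴴ (Bᴴ * X) (-(g • 1)) Dᴴ C D (-1))).PosDef)
    (hs : star s + s = 0) (hT : A * T + B = s • T) (hW : W = C * T + D) :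
    (g • (1 : Matrix b b ℂ) - Wᴴ * W).PosDef := by
  -- The congruence uses the harmonic response to the identity input: state T, input I, output W.
  -- For imaginary s the terms in X cancel, and only g - W†W remains.
  have hinj : Function.Injective (fromRows (fromRows T (1 : Matrix b b ℂ)) W).mulVec := by
    intro x y hxy
    have h1 := congrFun hxy
    funext i
    have h2 := h1 (Sum.inl (Sum.inr i))
    simpa [fromRows_mulVec] using h2
  have key := h.conjTranspose_mul_mul_same hinj
  convert key using 1
  have e1 : Bᴴ * X * T = star s • (Tᴴ * X * T) - Tᴴ * Aᴴ * X * T := by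
    have := congrArg conjTranspose hT
    rw [conjTranspose_add, conjTranspose_mul, conjTranspose_smul] at this
    rw [eq_sub_of_add_eq' this, Matrix.sub_mul, Matrix.sub_mul, Matrix.smul_mul, Matrix.smul_mul]
  have e2 : Tᴴ * X * B = s • (Tᴴ * X * T) - Tᴴ * X * A * T := by
    rw [eq_sub_of_add_eq' hT, Matrix.mul_sub, Matrix.mul_smul, ← Matrix.mul_assoc]
  have e3 : Tᴴ * Cᴴ = Wᴴ - Dᴴ := by
    rw [hW, conjTranspose_add, conjTranspose_mul, add_sub_cancel_right]
  have e4 : Wᴴ * C * T + Wᴴ * D = Wᴴ * W := by rw [hW, Matrix.mul_add, Matrix.mul_assoc]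
  have e5 : star s • (Tᴴ * X * T) = -(s • (Tᴴ * X * T)) := by
    rw [eq_neg_iff_add_eq_zero, ← add_smul, hs, zero_smul]
  simp only [blocks3, conjTranspose_fromRows_eq_fromCols_conjTranspose, conjTranspose_one,
    Matrix.mul_neg, Matrix.neg_mul, fromCols_mul_fromBlocks, fromCols_mul_fromRows,
    fromBlocks_mul_fromRows, mul_fromCols, Matrix.mul_add, Matrix.add_mul, Matrix.mul_one,
    Matrix.one_mul, ← Matrix.mul_assoc]
  rw [e1, e2, e3, e4, e5, Matrix.sub_mul]
  abel

end PosDef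

namespace FactorData

variable {m n ny p m11 : ℕ} (R : FactorData m n ny p)

/-- The state matrix of the dual of `[H₁₁ I] Υ`. -/
def Ahat (F : FilterData m11 n ny) : Matrix (Fin m ⊕ Fin m11) (Fin m ⊕ Fin m11) ℂ :=
  fromBlocks R.Aᴴ (R.C1ᴴ * F.Bᴴ) 0 F.Aᴴ

def Bhat (F : FilterData m11 n ny) : Matrix (Fin m ⊕ Fin m11) (Fin n) ℂ :=
  fromRows (R.C1ᴴ * F.Jᴴ + R.C2ᴴ) F.Cᴴ

def Chat (F : FilterData m11 n ny) : Matrix (Fin p) (Fin m ⊕ Fin m11) ℂ :=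
  fromCols R.Bᴴ (R.D1ᴴ * F.Bᴴ)

def Dhat (F : FilterData m11 n ny) : Matrix (Fin p) (Fin n) ℂ := R.D1ᴴ * F.Jᴴ + R.D2ᴴ

/-- The filter inequality in the form of the bounded real lemma. -/
theorem filterLMI_matrix_eq (γbar : ℝ) (F : FilterData m11 n ny)
    {X : Matrix (Fin m ⊕ Fin m11) (Fin m ⊕ Fin m11) ℂ} (hX : Xᴴ = X) :
    R.SigmaX γbar X + (PiMat m n p m11)ᴴ * F.Kᴴ * R.LambdaX X
        + (R.LambdaX X)ᴴ * F.K * PiMat m n p m11 =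
      blocks3 ((R.Ahat F)ᴴ * X + X * R.Ahat F) (X * R.Bhat F) (R.Chat F)ᴴ
        ((R.Bhat F)ᴴ * X) (-(((γbar : ℂ) ^ 2) • 1)) (R.Dhat F)ᴴ (R.Chat F) (R.Dhat F) (-1) := by
  set Cu : Matrix (Fin m11 ⊕ Fin n) (Fin m ⊕ Fin m11) ℂ := fromBlocks 0 1 0 0 with hCu
  set Du : Matrix (Fin m11 ⊕ Fin n) (Fin n) ℂ := fromRows 0 1 with hDu
  have hA : R.Ahat F = R.Abar m11 + R.Bund m11 * F.K * Cu := by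
    simp [Ahat, Abar, Bund, FilterData.K, hCu, fromBlocks_multiply, fromBlocks_add]
  have hB : R.Bhat F = R.Bbar m11 + R.Bund m11 * F.K * Du := by
    rw [Bhat, Bbar, Bund, FilterData.K, hDu, fromBlocks_multiply, fromBlocks_mul_fromRows]
    ext (i | i) j <;> simp [add_comm]
  have hC : R.Chat F = R.Cbar m11 + R.D12und m11 * F.K * Cu := by
    rw [Chat, Cbar, D12und, FilterData.K, hCu, fromCols_mul_fromBlocks, fromCols_mul_fromBlocks]
    ext i (j | j) <;> simp
  have hD : R.Dhat F = R.Dbar + R.D12und m11 * F.K * Du := by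
    rw [Dhat, Dbar, D12und, FilterData.K, hDu, fromCols_mul_fromBlocks, fromCols_mul_fromRows]
    simp [add_comm]
  have hL : (R.LambdaX X)ᴴ * F.K * PiMat m n p m11 =
      fromBlocks (fromBlocks (X * (R.Bund m11 * F.K * Cu)) (X * (R.Bund m11 * F.K * Du)) 0 0) 0
        (fromCols (R.D12und m11 * F.K * Cu) (R.D12und m11 * F.K * Du)) 0 := by
    rw [LambdaX, PiMat, conjTranspose_fromCols_eq_fromRows_conjTranspose,
      conjTranspose_fromCols_eq_fromRows_conjTranspose, conjTranspose_mul,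
      conjTranspose_conjTranspose, conjTranspose_conjTranspose, hX, conjTranspose_zero,
      ← hCu, ← hDu]
    simp only [fromRows_mul, mul_fromCols, Matrix.zero_mul, Matrix.mul_zero, Matrix.mul_assoc]
    ext ((i | i) | i) ((j | j) | j) <;> simp
  have hLH : (PiMat m n p m11)ᴴ * F.Kᴴ * R.LambdaX X =
      ((R.LambdaX X)ᴴ * F.K * PiMat m n p m11)ᴴ := by
    rw [conjTranspose_mul, conjTranspose_mul, conjTranspose_conjTranspose, Matrix.mul_assoc]
  rw [hLH, hL, hA, hB, hC, hD, SigmaX, blocks3, blocks3]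
  simp only [fromBlocks_conjTranspose, conjTranspose_fromCols_eq_fromRows_conjTranspose,
    conjTranspose_zero, conjTranspose_add, conjTranspose_mul X, hX, fromBlocks_add, add_zero,
    Matrix.add_mul, Matrix.mul_add]
  congr 1
  · congr 1; abel
  · ext (i | i) j <;> simp
  · ext i (j | j) <;> simp

variable {R}

theorem FilterLMI.bounded_real {γbar : ℝ} {F : FilterData m11 n ny}
    {X : Matrix (Fin m ⊕ Fin m11) (Fin m ⊕ Fin m11) ℂ} (h : R.FilterLMI γbar F X) :
    (-(blocks3 ((R.Ahat F)ᴴ * X + X * R.Ahat F) (X * R.Bhat F) (R.Chat F)ᴴ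
        ((R.Bhat F)ᴴ * X) (-(((γbar : ℂ) ^ 2) • 1)) (R.Dhat F)ᴴ (R.Chat F) (R.Dhat F)
        (-1))).PosDef := by
  rw [← R.filterLMI_matrix_eq γbar F h.1.1]
  exact h.2

theorem det_smul_one_sub_conjTranspose {x : Type} [Fintype x] [DecidableEq x] (A : Matrix x x ℂ)
    (s : ℂ) : (star s • (1 : Matrix x x ℂ) - Aᴴ).det = star (s • (1 : Matrix x x ℂ) - A).det := by
  rw [← det_conjTranspose, conjTranspose_sub, conjTranspose_smul, conjTranspose_one]

/-- The corner of the inequality is a Lyapunov inequality for Â. This matrix is block triangular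
with diagonal blocks A_λ† and A₁₁†, so both A_λ and A₁₁ have no eigenvalue in the closed right
half-plane; the adjoints are the reason for working at the conjugate of s. -/
theorem FilterLMI.det_ne_zero {γbar : ℝ} {F : FilterData m11 n ny}
    {X : Matrix (Fin m ⊕ Fin m11) (Fin m ⊕ Fin m11) ℂ} (h : R.FilterLMI γbar F X) {s : ℂ}
    (hs : 0 ≤ s.re) :
    (s • (1 : Matrix (Fin m) (Fin m) ℂ) - R.A).det ≠ 0 ∧
      (s • (1 : Matrix (Fin m11) (Fin m11) ℂ) - F.A).det ≠ 0 := by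
  have h1 := h.bounded_real.submatrix (e := fun i => Sum.inl (Sum.inl i))
    (Sum.inl_injective.comp Sum.inl_injective)
  have h2 : (-((R.Ahat F)ᴴ * X + X * R.Ahat F)).PosDef := by
    convert h1 using 1
    ext i j; rfl
  have h3 := det_ne_zero_of_lyapunov h.1 h2 (s := star s) (by simpa using hs)
  have h4 : star s • (1 : Matrix (Fin m ⊕ Fin m11) (Fin m ⊕ Fin m11) ℂ) - R.Ahat F =
      fromBlocks (star s • 1 - R.Aᴴ) (-(R.C1ᴴ * F.Bᴴ)) 0 (star s • 1 - F.Aᴴ) := by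
    rw [Ahat, ← fromBlocks_one, fromBlocks_smul, sub_eq_add_neg, fromBlocks_neg, fromBlocks_add]
    simp [sub_eq_add_neg]
  rw [h4, det_fromBlocks_zero₂₁, det_smul_one_sub_conjTranspose,
    det_smul_one_sub_conjTranspose] at h3
  exact ⟨fun h => h3 (by simp [h]), fun h => h3 (by simp [h])⟩

/-- The hatted system realizes the dual of [H₁₁ I]Υ. Its response at z* has filter part T₂ = (z -
A₁₁)⁻†C₁₁† and factor part T₁ = (z - A_λ)⁻†(C₁†H₁₁† + C₂†), and its output is Q†. -/
theorem FilterLMI.posDef_at {γbar : ℝ} {F : FilterData m11 n ny}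
    {X : Matrix (Fin m ⊕ Fin m11) (Fin m ⊕ Fin m11) ℂ} (h : R.FilterLMI γbar F X) {z : ℂ}
    (hz : z.re = 0) {Q : Matrix (Fin n) (Fin p) ℂ}
    (hQ : Q = fromCols (evalAt F.toTransfer z) (1 : Matrix (Fin n) (Fin n) ℂ) *
      evalAt (transfer R.A R.B (fromRows R.C1 R.C2) (fromRows R.D1 R.D2)) z) :
    (((γbar : ℂ) ^ 2) • (1 : Matrix (Fin n) (Fin n) ℂ) - Q * Qᴴ).PosDef := by
  obtain ⟨hR, hF⟩ := h.det_ne_zero (s := z) hz.ge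
  rw [FilterData.toTransfer, evalAt_transfer hR, evalAt_transfer hF] at hQ
  set r1 := (z • (1 : Matrix (Fin m) (Fin m) ℂ) - R.A)⁻¹ with hr1
  set r2 := (z • (1 : Matrix (Fin m11) (Fin m11) ℂ) - F.A)⁻¹ with hr2
  have k1 : R.Aᴴ * r1ᴴ + 1 = star z • r1ᴴ := by
    have e := congrArg conjTranspose (Matrix.nonsing_inv_mul _ (isUnit_iff_ne_zero.2 hR))
    rw [← hr1, conjTranspose_mul, conjTranspose_sub, conjTranspose_smul, conjTranspose_one,
      Matrix.sub_mul, Matrix.smul_mul, Matrix.one_mul] at e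
    rw [← e]; abel
  have k2 : F.Aᴴ * r2ᴴ + 1 = star z • r2ᴴ := by
    have e := congrArg conjTranspose (Matrix.nonsing_inv_mul _ (isUnit_iff_ne_zero.2 hF))
    rw [← hr2, conjTranspose_mul, conjTranspose_sub, conjTranspose_smul, conjTranspose_one,
      Matrix.sub_mul, Matrix.smul_mul, Matrix.one_mul] at e
    rw [← e]; abel
  set H := F.C * r2 * F.B + F.J with hH
  set T2 := r2ᴴ * F.Cᴴ with hT2
  set T1 := r1ᴴ * (R.C1ᴴ * Hᴴ + R.C2ᴴ) with hT1
  have hHH : Hᴴ = F.Bᴴ * T2 + F.Jᴴ := by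
    rw [hH, hT2]
    simp only [conjTranspose_add, conjTranspose_mul, Matrix.mul_assoc]
  have key := bounded_real_at (T := fromRows T1 T2) (W := Qᴴ) (s := star z) h.bounded_real ?_ ?_ ?_
  · rwa [conjTranspose_conjTranspose] at key
  · apply Complex.ext <;> simp [hz]
  · have c1 : R.Aᴴ * T1 + (R.C1ᴴ * Hᴴ + R.C2ᴴ) = star z • T1 := by
      rw [hT1, ← Matrix.mul_assoc, ← Matrix.smul_mul, ← k1, Matrix.add_mul, Matrix.one_mul]
    have c2 : F.Aᴴ * T2 + F.Cᴴ = star z • T2 := by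
      rw [hT2, ← Matrix.mul_assoc, ← Matrix.smul_mul, ← k2, Matrix.add_mul, Matrix.one_mul]
    rw [Ahat, Bhat, fromBlocks_mul_fromRows]
    have c3 : star z • fromRows T1 T2 = fromRows (star z • T1) (star z • T2) := by
      ext (i | i) j <;> rfl
    rw [c3, ← c1, ← c2, hHH]
    ext (i | i) j
    · simp [Matrix.mul_add, Matrix.mul_assoc]; ring
    · simp
  · rw [hQ, Chat, Dhat, fromCols_mul_fromRows]
    have c4 : (fromRows (R.C1 * r1) (R.C2 * r1)) * R.B + fromRows R.D1 R.D2 =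
        fromRows (R.C1 * r1 * R.B + R.D1) (R.C2 * r1 * R.B + R.D2) := by
      rw [fromRows_mul]
      ext (i | i) j <;> rfl
    rw [fromRows_mul, c4, fromCols_mul_fromRows, conjTranspose_add, Matrix.one_mul,
      conjTranspose_mul]
    have c5 : (R.C1 * r1 * R.B + R.D1)ᴴ = R.Bᴴ * r1ᴴ * R.C1ᴴ + R.D1ᴴ := by
      simp [Matrix.mul_assoc]
    have c6 : (R.C2 * r1 * R.B + R.D2)ᴴ = R.Bᴴ * r1ᴴ * R.C2ᴴ + R.D2ᴴ := by
      simp [Matrix.mul_assoc]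
    rw [c5, c6, hT1, Matrix.add_mul (R.Bᴴ * r1ᴴ * R.C1ᴴ)]
    -- Only the H† in the direct term D₁†H† is expanded, into D₁†B₁₁†T₂ + D₁†J₁₁†; the occurrences
    -- behind the resolvent agree on both sides as they stand.
    nth_rewrite 2 [hHH]
    simp only [Matrix.mul_add, Matrix.mul_assoc]
    abel

end FactorData

/-! ### Error density and strict contractivity -/

namespace Channel

variable {n nw ny nd k : ℕ} (S : Channel n nw ny nd k)

/-- With a factorization `Φ_λ = Υ Υ^H`, the error density is `Q Q^H - λ²`, `Q = [H₁₁ I] Υ`. -/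
theorem blockPSD_eq_factor {p : ℕ} {lam : ℝ} {Ups : TransferMatrix (Fin ny ⊕ Fin n) (Fin p)}
    (hUps : S.PhiLam lam = Ups * paraConj Ups) (H11 : TransferMatrix (Fin n) (Fin ny)) :
    S.blockPSD H11 = (fromCols H11 (1 : TransferMatrix (Fin n) (Fin n)) * Ups) *
      (fromCols H11 (1 : TransferMatrix (Fin n) (Fin n)) * Ups)ᴴ
        - const (((lam : ℂ) ^ 2) • (1 : Matrix (Fin n) (Fin n) ℂ)) := by
  have e1 : const (fromBlocks (0 : Matrix (Fin ny) (Fin ny) ℂ) 0 0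
      (((lam : ℂ) ^ 2) • (1 : Matrix (Fin n) (Fin n) ℂ))) =
      fromBlocks 0 0 0 (const (((lam : ℂ) ^ 2) • (1 : Matrix (Fin n) (Fin n) ℂ))) := by
    ext (i | i) (j | j) <;> simp [const]
  have e2 : S.Phi = Ups * Upsᴴ - fromBlocks 0 0 0
      (const (((lam : ℂ) ^ 2) • (1 : Matrix (Fin n) (Fin n) ℂ))) := by
    rw [← e1, eq_sub_iff_add_eq]
    exact hUps
  rw [blockPSD, paraConj_eq_conjTranspose, e2, Matrix.mul_sub, Matrix.sub_mul,
    fromCols_mul_fromBlocks, fromCols_mul_fromRows, conjTranspose_mul,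
    conjTranspose_fromCols_eq_fromRows_conjTranspose, conjTranspose_one]
  simp [Matrix.mul_assoc]

theorem Phi_axisRing {p : ℕ} {lam : ℝ} {Ups : TransferMatrix (Fin ny ⊕ Fin n) (Fin p)}
    (hUps : S.PhiLam lam = Ups * paraConj Ups) (h : EntriesIn axisRing Ups) :
    EntriesIn axisRing S.Phi := by
  have e : S.Phi = Ups * Upsᴴ - const (fromBlocks 0 0 0 (((lam : ℂ) ^ 2) • 1)) := by
    rw [eq_sub_iff_add_eq]; exact hUps
  rw [e]
  exact (h.mul h.conjTranspose).sub (EntriesIn.const_axisRing _)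

/-- Under the low signal-to-noise condition suboptimal filters are strictly contractive. -/
theorem strictly_contractive_of_bounded (hPhi : EntriesIn axisRing S.Phi)
    {H11 : TransferMatrix (Fin n) (Fin ny)} (hH : EntriesIn axisRing H11) {γ γ' : ℝ}
    (hγ : S.LowSNRCondition γ) (hle : γ' ^ 2 ≤ γ ^ 2) (hb : BoundedBySq (S.blockPSD H11) γ') :
    OnClosedAxis H11 (fun M => (1 - M * Mᴴ).PosDef) := by
  obtain ⟨θ, hθ, hax⟩ := hγ
  rw [onClosedAxis_iff hPhi.proper] at hax
  rw [onClosedAxis_iff hH.proper]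
  intro l hl V hV
  have := hl.neBot
  obtain ⟨M, hM⟩ := exists_tendsto_freq hl hPhi.proper
  have h1 := hax l hl M hM
  have hinj : Function.Injective (fromCols V (1 : Matrix (Fin n) (Fin n) ℂ)).vecMul := by
    intro x y hxy
    funext i
    have h2 := congrFun hxy (Sum.inr i)
    simpa [vecMul_fromCols] using h2
  have h2 := h1.mul_mul_conjTranspose_same hinj
  obtain ⟨L, hL⟩ : ∃ L : Matrix (Fin n) (Fin n) ℂ, L =
    (fromCols V (1 : Matrix (Fin n) (Fin n) ℂ) : Matrix (Fin n) (Fin ny ⊕ Fin n) ℂ) * M *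
      (fromRows Vᴴ (1 : Matrix (Fin n) (Fin n) ℂ) : Matrix (Fin ny ⊕ Fin n) (Fin n) ℂ) := ⟨_, rfl⟩
  have hP : Tendsto (freq (S.blockPSD H11)) l (𝓝 L) := by
    rw [hL]
    have hc : Tendsto (freq (fromCols H11 (1 : TransferMatrix (Fin n) (Fin n)))) l
        (𝓝 (fromCols V 1)) := by
      refine tendsto_pi_nhds.2 fun i => tendsto_pi_nhds.2 fun j => ?_
      rcases j with j | j
      · exact tendsto_pi_nhds.1 (tendsto_pi_nhds.1 hV i) j
      · refine tendsto_const_nhds.congr fun ω => ?_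
        exact (congrFun (congrFun (freq_one (a := Fin n) ω) i) j).symm
    have hc' := tendsto_freq_conjTranspose (hH.fromCols EntriesIn.one) hc
    rw [conjTranspose_fromCols_eq_fromRows_conjTranspose, conjTranspose_one,
      conjTranspose_fromCols_eq_fromRows_conjTranspose, conjTranspose_one] at hc'
    exact tendsto_freq_mul ((hH.fromCols EntriesIn.one).mul hPhi)
      (hH.conjTranspose.fromRows EntriesIn.one)
      (tendsto_freq_mul (hH.fromCols EntriesIn.one) hPhi hc hM) hc'
  -- Passing to the limit at infinity loses strictness, so this term is only semidefinite. The
  -- strict sign comes from the low signal-to-noise condition.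
  have h3 : (((γ' : ℂ) ^ 2) • (1 : Matrix (Fin n) (Fin n) ℂ) - L).PosSemidef :=
    posSemidef_of_tendsto (tendsto_const_nhds.sub hP) (Eventually.of_forall fun ω => (hb ω).posSemidef)
  have h4 : ((((γ ^ 2 - γ' ^ 2 : ℝ)) : ℂ) • (1 : Matrix (Fin n) (Fin n) ℂ)).PosSemidef :=
    PosSemidef.one.smul (by rw [Complex.zero_le_real]; linarith)
  have h5 := (h3.add h4).smul (show (0 : ℂ) ≤ (θ : ℂ) by rw [Complex.zero_le_real]; exact hθ.le)
  -- The compressed condition equals θ(L - γ²) - (VV† - I); adding θ(γ'² - L) + θ(γ² - γ'²) leaves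
  -- exactly I - VV†.
  have h6 := h2.add_posSemidef h5
  convert h6 using 1
  have e1 : fromCols V (1 : Matrix (Fin n) (Fin n) ℂ) *
      (fromBlocks 0 0 0 (((γ : ℂ) ^ 2) • 1) : Matrix (Fin ny ⊕ Fin n) (Fin ny ⊕ Fin n) ℂ) *
      fromRows Vᴴ (1 : Matrix (Fin n) (Fin n) ℂ) =
        ((γ : ℂ) ^ 2) • (1 : Matrix (Fin n) (Fin n) ℂ) := by
    simp [fromCols_mul_fromBlocks, fromCols_mul_fromRows]
  have e2 : fromCols V (1 : Matrix (Fin n) (Fin n) ℂ) *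
      (fromBlocks 1 0 0 (-1) : Matrix (Fin ny ⊕ Fin n) (Fin ny ⊕ Fin n) ℂ) *
      fromRows Vᴴ (1 : Matrix (Fin n) (Fin n) ℂ) = V * Vᴴ - 1 := by
    simp [fromCols_mul_fromBlocks, fromCols_mul_fromRows, sub_eq_add_neg]
  rw [conjTranspose_fromCols_eq_fromRows_conjTranspose, conjTranspose_one, Matrix.mul_sub,
    Matrix.sub_mul, Matrix.mul_smul, Matrix.smul_mul, Matrix.mul_sub, Matrix.sub_mul, e1, e2, ← hL]
  push_cast
  module

theorem mem_contractiveSet_of_filterLMI {m m11 p : ℕ} {lam : ℝ}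
    {Ups : TransferMatrix (Fin ny ⊕ Fin n) (Fin p)} (hUps : S.PhiLam lam = Ups * paraConj Ups)
    (hax : EntriesIn axisRing Ups)
    {R : FactorData m n ny p} (hR : transfer R.A R.B (fromRows R.C1 R.C2) (fromRows R.D1 R.D2) = Ups)
    {γbar γ : ℝ} (hγ : γ ^ 2 = γbar ^ 2 - lam ^ 2) (hlow : S.LowSNRCondition γ)
    {F : FilterData m11 n ny} {X : Matrix (Fin m ⊕ Fin m11) (Fin m ⊕ Fin m11) ℂ}
    (h : R.FilterLMI γbar F X) : F.toTransfer ∈ S.contractiveSet γ := by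
  have hst : EntriesIn stableRing F.toTransfer := fun i j =>
    mem_stableRing.2 ⟨transfer_proper _ _ _ _ i j,
      fun s hs => transfer_regularAt (h.det_ne_zero hs).2 _ _ _ i j⟩
  have hF := hst.mono stableRing_le_axisRing
  have hb : BoundedBySq (S.blockPSD F.toTransfer) γ := by
    intro ω
    have hc := hF.fromCols (EntriesIn.one (T := axisRing) (a := Fin n))
    have hQ := h.posDef_at (z := Complex.I * (ω : ℂ)) (by simp) rfl
    rw [S.blockPSD_eq_factor hUps, freq_sub ((hc.mul hax).mul (hc.mul hax).conjTranspose)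
      (EntriesIn.const_axisRing _), freq_mul (hc.mul hax) (hc.mul hax).conjTranspose,
      freq_conjTranspose' (hc.mul hax), freq_mul hc hax, freq_const]
    have e1 : freq (fromCols F.toTransfer (1 : TransferMatrix (Fin n) (Fin n))) ω =
        fromCols (evalAt F.toTransfer (Complex.I * (ω : ℂ))) 1 := by
      rw [freq, evalAt_fromCols, evalAt_one]
    rw [e1, ← hR]
    convert hQ using 1
    have e2 : ((γ : ℂ) ^ 2) = (γbar : ℂ) ^ 2 - (lam : ℂ) ^ 2 := by exact_mod_cast hγ
    rw [e2, freq]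
    module
  have hps := isProper_and_isStable_iff.2 hst
  exact ⟨hps.1, hps.2, hb, S.strictly_contractive_of_bounded
    (S.Phi_axisRing hUps hax) hF hlow le_rfl hb⟩

end Channel

/-! ### The projection lemma -/

section projection

variable {N a b c d : Type} [Fintype N] [Fintype a] [Fintype b] [Fintype c] [Fintype d]

theorem posDef_of_re_pos {M : Matrix N N ℂ} (hM : M.IsHermitian)
    (h : ∀ x : N → ℂ, x ≠ 0 → 0 < (star x ⬝ᵥ M *ᵥ x).re) : M.PosDef := by
  refine PosDef.of_dotProduct_mulVec_pos hM fun x hx => ?_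
  rw [Complex.pos_iff]
  exact ⟨h x hx, (hM.im_star_dotProduct_mulVec_self x).symm⟩

theorem re_pos_of_posDef {M : Matrix N N ℂ} (hM : M.PosDef) {x : N → ℂ} (hx : x ≠ 0) :
    0 < (star x ⬝ᵥ M *ᵥ x).re := (Complex.pos_iff.1 (hM.dotProduct_mulVec_pos hx)).1

theorem star_dotProduct_conjTranspose_mul_mul (M : Matrix N N ℂ) (V : Matrix N a ℂ) (x : a → ℂ) :
    star x ⬝ᵥ (Vᴴ * M * V) *ᵥ x = star (V *ᵥ x) ⬝ᵥ M *ᵥ (V *ᵥ x) := by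
  rw [star_mulVec, ← dotProduct_mulVec, mulVec_mulVec, mulVec_mulVec, Matrix.mul_assoc]

/-- Finsler's lemma. -/
theorem finsler {S : Matrix N N ℂ} (hS : S.IsHermitian) (Q : Matrix b N ℂ)
    (h : ∀ x : N → ℂ, x ≠ 0 → Q *ᵥ x = 0 → 0 < (star x ⬝ᵥ S *ᵥ x).re) :
    ∃ ρ : ℝ, 0 < ρ ∧ (S + (ρ : ℂ) • (Qᴴ * Q)).PosDef := by
  classical
  set f : (N → ℂ) → ℝ := fun x => (star x ⬝ᵥ S *ᵥ x).re with hf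
  set g : (N → ℂ) → ℝ := fun x => (star (Q *ᵥ x) ⬝ᵥ (Q *ᵥ x)).re with hg
  have hfc : Continuous f := by
    refine Complex.continuous_re.comp ?_; fun_prop
  have hgc : Continuous g := by
    refine Complex.continuous_re.comp ?_; fun_prop
  have hg0 : ∀ x, 0 ≤ g x := fun x => (Complex.nonneg_iff.1 (dotProduct_star_self_nonneg _)).1
  have hgpos : ∀ x, Q *ᵥ x ≠ 0 → 0 < g x := fun x hx =>
    (Complex.pos_iff.1 (dotProduct_star_self_pos_iff.2 hx)).1
  -- On the unit sphere f + kg becomes positive for large k: where g vanishes f is positive by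
  -- hypothesis, elsewhere g > 0. The open sets grow with k, so by compactness one k serves the
  -- whole sphere, and homogeneity of degree 2 does the rest.
  obtain ⟨k, hk⟩ := (isCompact_sphere (0 : N → ℂ) 1).elim_directed_cover
    (fun k : ℕ => {x | 0 < f x + k * g x})
    (fun k => isOpen_lt continuous_const (hfc.add (continuous_const.mul hgc)))
    (by
      intro x hx
      rw [Set.mem_iUnion]
      have hx0 : x ≠ 0 := by
        rintro rfl
        simp at hx
      by_cases hQ : Q *ᵥ x = 0
      · exact ⟨0, by simpa using h x hx0 hQ⟩
      · obtain ⟨k, hk⟩ := exists_nat_gt (-f x / g x)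
        refine ⟨k, ?_⟩
        rw [div_lt_iff₀ (hgpos x hQ)] at hk
        simp only [Set.mem_ofPred_eq]
        linarith)
    (directed_of_isDirected_le fun i j hij x hx => by
      have : (i : ℝ) * g x ≤ j * g x := mul_le_mul_of_nonneg_right (by exact_mod_cast hij) (hg0 x)
      simp only [Set.mem_ofPred_eq] at hx ⊢
      linarith)
  -- The increment makes ρ strictly positive even if k = 0, and costs nothing because g ≥ 0.
  refine ⟨k + 1, by positivity, posDef_of_re_pos ?_ ?_⟩
  · refine hS.add ?_
    rw [IsHermitian, conjTranspose_smul, conjTranspose_mul, conjTranspose_conjTranspose]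
    simp
  intro x hx
  have e : ∀ x, (star x ⬝ᵥ (S + ((k + 1 : ℝ) : ℂ) • (Qᴴ * Q)) *ᵥ x).re = f x + (k + 1) * g x := by
    intro x
    rw [add_mulVec, smul_mulVec, dotProduct_add, dotProduct_smul, ← mulVec_mulVec,
      dotProduct_mulVec _ Qᴴ, ← star_mulVec, Complex.add_re, smul_eq_mul, Complex.re_ofReal_mul]
  have hnx : 0 < ‖x‖ := norm_pos_iff.2 hx
  have hs : ∀ (r : ℝ) (x : N → ℂ), f ((r : ℂ) • x) = r ^ 2 * f x ∧ g ((r : ℂ) • x) = r ^ 2 * g x := by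
    intro r x
    constructor
    · simp only [hf, mulVec_smul, star_smul, dotProduct_smul, smul_dotProduct, smul_eq_mul]
      rw [Complex.star_def, Complex.conj_ofReal, Complex.re_ofReal_mul, Complex.re_ofReal_mul]
      ring
    · simp only [hg, mulVec_smul, star_smul, dotProduct_smul, smul_dotProduct, smul_eq_mul]
      rw [Complex.star_def, Complex.conj_ofReal, Complex.re_ofReal_mul, Complex.re_ofReal_mul]
      ring
  have hmem : ((‖x‖⁻¹ : ℝ) : ℂ) • x ∈ Metric.sphere (0 : N → ℂ) 1 := by
    rw [mem_sphere_zero_iff_norm, norm_smul, Complex.norm_real, norm_inv, norm_norm,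
      inv_mul_cancel₀ hnx.ne']
  have h1 := hk hmem
  simp only [Set.mem_ofPred_eq] at h1
  rw [(hs _ x).1, (hs _ x).2] at h1
  rw [e x]
  have h2 : 0 < (‖x‖⁻¹) ^ 2 * (f x + k * g x) := by linarith
  have h3 := (pos_iff_pos_of_mul_pos h2).1 (by positivity)
  linarith [hg0 x]

theorem posDef_negative_on_ker {S : Matrix N N ℂ} {V : Matrix N c ℂ} {a : Type} {P : Matrix a N ℂ}
    (hV : (Vᴴ * S * V).PosDef) (hP : ∀ x, P *ᵥ x = 0 → ∃ y, x = V *ᵥ y) (x : N → ℂ) (hx : x ≠ 0)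
    (hPx : P *ᵥ x = 0) : 0 < (star x ⬝ᵥ S *ᵥ x).re := by
  obtain ⟨y, rfl⟩ := hP x hPx
  have hy : y ≠ 0 := by rintro rfl; simp at hx
  rw [← star_dotProduct_conjTranspose_mul_mul]
  exact re_pos_of_posDef hV hy

/-- The projection lemma, for `P` with orthonormal rows. -/
theorem projection_lemma [DecidableEq N] [DecidableEq a] {S : Matrix N N ℂ} (hS : S.IsHermitian)
    {P : Matrix a N ℂ} (hPP : P * Pᴴ = 1) {Q : Matrix b N ℂ} {V : Matrix N c ℂ} {W : Matrix N d ℂ}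
    (hV : (Vᴴ * S * V).PosDef) (hPV : ∀ x, P *ᵥ x = 0 → ∃ y, x = V *ᵥ y)
    (hW : (Wᴴ * S * W).PosDef) (hQW : ∀ x, Q *ᵥ x = 0 → ∃ y, x = W *ᵥ y) :
    ∃ K : Matrix b a ℂ, (S + (Pᴴ * Kᴴ * Q + Qᴴ * K * P)).PosDef := by
  obtain ⟨ρ, hρ, hT⟩ := finsler hS Q (posDef_negative_on_ker hW hQW)
  set T := S + (ρ : ℂ) • (Qᴴ * Q) with hTdef
  have hinj : Function.Injective P.vecMul := by
    intro x y hxy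
    have := congrArg (fun z => z ᵥ* Pᴴ) hxy
    simpa [vecMul_vecMul, hPP] using this
  have hZ : (P * T⁻¹ * Pᴴ).PosDef := hT.inv.mul_mul_conjTranspose_same hinj
  set Z := P * T⁻¹ * Pᴴ with hZdef
  have hTi : T⁻¹ᴴ = T⁻¹ := hT.inv.1
  have hTT : T * T⁻¹ = 1 := Matrix.mul_nonsing_inv _ ((Matrix.isUnit_iff_isUnit_det _).1 hT.isUnit)
  have hZi : Z⁻¹ᴴ = Z⁻¹ := hZ.inv.1
  have hZZ : Z * Z⁻¹ = 1 := Matrix.mul_nonsing_inv _ ((Matrix.isUnit_iff_isUnit_det _).1 hZ.isUnit)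
  set L := Q * T⁻¹ * Pᴴ * Z⁻¹ with hL
  -- F is the projection along Ker P that is orthogonal for the inner product of T: PF = P, and TF
  -- is Hermitian. The gain L is chosen so that LP = QF.
  set F := T⁻¹ * Pᴴ * Z⁻¹ * P with hF
  have hLP : L * P = Q * F := by
    rw [hL, hF]; simp only [Matrix.mul_assoc]
  have hTF : T * F = Pᴴ * Z⁻¹ * P := by
    rw [hF, ← Matrix.mul_assoc, ← Matrix.mul_assoc, ← Matrix.mul_assoc, hTT, Matrix.one_mul]
  have hFT : Fᴴ * T = Pᴴ * Z⁻¹ * P := by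
    have := congrArg conjTranspose hTF
    rw [conjTranspose_mul, hT.1.eq] at this
    rw [this, conjTranspose_mul, conjTranspose_mul, conjTranspose_conjTranspose, hZi,
      Matrix.mul_assoc]
  have hPF : P * F = P := by
    have : P * F = Z * Z⁻¹ * P := by rw [hF, hZdef]; simp only [Matrix.mul_assoc]
    rw [this, hZZ, Matrix.one_mul]
  have hFTF : Fᴴ * T * F = Pᴴ * Z⁻¹ * P := by
    rw [hFT, Matrix.mul_assoc, hPF]
  clear_value F L Z
  refine ⟨(ρ : ℂ) • L, ?_⟩
  have hρstar : star (ρ : ℂ) = ρ := Complex.conj_ofReal ρ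
  have e1 : Pᴴ * ((ρ : ℂ) • L)ᴴ * Q + Qᴴ * ((ρ : ℂ) • L) * P =
      (ρ : ℂ) • (Fᴴ * Qᴴ * Q + Qᴴ * Q * F) := by
    have e2 : Pᴴ * Lᴴ = Fᴴ * Qᴴ := by
      rw [← conjTranspose_mul, hLP, conjTranspose_mul]
    rw [conjTranspose_smul, hρstar, Matrix.mul_smul, Matrix.smul_mul, e2, Matrix.mul_smul,
      Matrix.smul_mul, Matrix.mul_assoc Qᴴ, hLP, smul_add, Matrix.mul_assoc Qᴴ]
  have hST : S = T - (ρ : ℂ) • (Qᴴ * Q) := by rw [hTdef]; abel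
  -- Completion of the square. I - F maps into Ker P, where S is positive, and the directions on
  -- which I - F vanishes are covered by F†TF.
  have key : S + (Pᴴ * ((ρ : ℂ) • L)ᴴ * Q + Qᴴ * ((ρ : ℂ) • L) * P) =
      (1 - F)ᴴ * S * (1 - F) + Fᴴ * T * F + (ρ : ℂ) • ((Q * F)ᴴ * (Q * F)) := by
    rw [e1]
    have e3 : (1 - F)ᴴ * S * (1 - F) = S - Fᴴ * S - S * F + Fᴴ * S * F := by
      rw [conjTranspose_sub, conjTranspose_one]
      simp only [Matrix.sub_mul, Matrix.mul_sub, Matrix.one_mul, Matrix.mul_one]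
      abel
    have e4 : Fᴴ * S = Fᴴ * T - (ρ : ℂ) • (Fᴴ * (Qᴴ * Q)) := by
      rw [hST, Matrix.mul_sub, Matrix.mul_smul]
    have e5 : S * F = T * F - (ρ : ℂ) • (Qᴴ * Q * F) := by
      rw [hST, Matrix.sub_mul, Matrix.smul_mul]
    rw [e3, e4, e5, Matrix.sub_mul, Matrix.smul_mul, hFTF, hFT, hTF, conjTranspose_mul]
    simp only [Matrix.mul_assoc, smul_add]
    abel
  rw [key]
  have hFH : (Fᴴ * T * F).PosSemidef := hT.posSemidef.conjTranspose_mul_mul_same F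
  have hQF : ((ρ : ℂ) • ((Q * F)ᴴ * (Q * F))).PosSemidef :=
    (posSemidef_conjTranspose_mul_self (Q * F)).smul (by rw [Complex.zero_le_real]; exact hρ.le)
  refine PosDef.add_posSemidef (posDef_of_re_pos ?_ ?_) hQF
  · exact (isHermitian_conjTranspose_mul_mul _ hS).add hFH.1
  intro x hx
  rw [add_mulVec, dotProduct_add, Complex.add_re, star_dotProduct_conjTranspose_mul_mul,
    star_dotProduct_conjTranspose_mul_mul]
  have hPy : P *ᵥ ((1 - F) *ᵥ x) = 0 := by
    rw [mulVec_mulVec, Matrix.mul_sub, hPF, Matrix.mul_one, sub_self, zero_mulVec]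
  by_cases hy : (1 - F) *ᵥ x = 0
  · have hFx : F *ᵥ x = x := by
      rw [sub_mulVec, one_mulVec, sub_eq_zero] at hy; exact hy.symm
    rw [hy, hFx]
    simpa using re_pos_of_posDef hT hx
  · refine add_pos_of_pos_of_nonneg (posDef_negative_on_ker hV hPV _ hy hPy) ?_
    exact (Complex.nonneg_iff.1 (hT.posSemidef.dotProduct_mulVec_nonneg _)).1

theorem posDef_fromBlocks_diagonal {A : Matrix a a ℂ} {D : Matrix b b ℂ} (hA : A.PosDef)
    (hD : D.PosDef) : (fromBlocks A 0 0 D).PosDef := by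
  refine PosDef.of_dotProduct_mulVec_pos (hA.1.fromBlocks (by simp) hD.1) fun x hx => ?_
  obtain ⟨y, z, rfl⟩ : ∃ y z, x = Sum.elim y z := ⟨x ∘ Sum.inl, x ∘ Sum.inr, by simp⟩
  rw [fromBlocks_mulVec]
  simp only [Sum.elim_comp_inl, Sum.elim_comp_inr, zero_mulVec, add_zero, zero_add]
  have e : star (Sum.elim y z) ⬝ᵥ Sum.elim (A *ᵥ y) (D *ᵥ z) =
      star y ⬝ᵥ A *ᵥ y + star z ⬝ᵥ D *ᵥ z := by
    simp [dotProduct, Fintype.sum_sum_type]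
  rw [e]
  by_cases hy : y = 0
  · have hz : z ≠ 0 := by
      rintro rfl
      exact hx (by ext (i | i) <;> simp [hy])
    exact add_pos_of_nonneg_of_pos (hA.posSemidef.dotProduct_mulVec_nonneg y)
      (hD.dotProduct_mulVec_pos hz)
  · exact add_pos_of_pos_of_nonneg (hA.dotProduct_mulVec_pos hy)
      (hD.posSemidef.dotProduct_mulVec_nonneg z)

/-- A Schur complement criterion. -/
theorem posDef_fromBlocks_one [DecidableEq a] [DecidableEq b] {A : Matrix a a ℂ} {B : Matrix a b ℂ}
    (h : (A - B * Bᴴ).PosDef) : (fromBlocks A B Bᴴ 1).PosDef := by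
  have hinj : Function.Injective (fromBlocks 1 B 0 1 : Matrix (a ⊕ b) (a ⊕ b) ℂ).vecMul := by
    refine vecMul_injective_of_isUnit ?_
    rw [Matrix.isUnit_iff_isUnit_det, det_fromBlocks_zero₂₁]
    simp
  have := (posDef_fromBlocks_diagonal h (PosDef.one (n := b) (R := ℂ))).mul_mul_conjTranspose_same
    hinj
  convert this using 1
  simp [fromBlocks_conjTranspose, fromBlocks_multiply]

end projection

/-! ### Completion of the certificate -/

section completion

/-- In the spectral decomposition only as many eigenvalues as the rank are nonzero. Their indices
embed into r columns, each carrying the square root of one eigenvalue; the remaining columns are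
zero. -/
theorem exists_mul_conjTranspose_of_rank_le {m r : ℕ} {D : Matrix (Fin m) (Fin m) ℂ}
    (hD : D.PosSemidef) (hr : D.rank ≤ r) :
    ∃ V : Matrix (Fin m) (Fin r) ℂ, V * Vᴴ = D := by
  classical
  have hcard : Fintype.card {i // hD.1.eigenvalues i ≠ 0} ≤ Fintype.card (Fin r) := by
    rw [← hD.1.rank_eq_card_non_zero_eigs, Fintype.card_fin]; exact hr
  obtain ⟨f⟩ := Function.Embedding.nonempty_of_card_le hcard
  set U : Matrix (Fin m) (Fin m) ℂ := (hD.1.eigenvectorUnitary : Matrix (Fin m) (Fin m) ℂ) with hU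
  set s : Fin m → ℂ := fun i => (Real.sqrt (hD.1.eigenvalues i) : ℂ) with hs
  set E : Matrix (Fin m) (Fin r) ℂ := fun i j =>
    if h : hD.1.eigenvalues i ≠ 0 then (if f ⟨i, h⟩ = j then s i else 0) else 0 with hE
  have hss : ∀ x : ℝ, 0 ≤ x → (Real.sqrt x : ℂ) * star (Real.sqrt x : ℂ) = x := fun x hx => by
    rw [Complex.star_def, Complex.conj_ofReal, ← Complex.ofReal_mul, Real.mul_self_sqrt hx]
  have hEE : E * Eᴴ = diagonal (RCLike.ofReal ∘ hD.1.eigenvalues) := by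
    ext i k
    rw [Matrix.mul_apply]
    simp only [conjTranspose_apply]
    by_cases hi : hD.1.eigenvalues i ≠ 0
    · rw [Finset.sum_eq_single (f ⟨i, hi⟩)]
      · by_cases hik : i = k
        · subst hik
          simp only [hE, dif_pos hi, if_true, diagonal_apply_eq, Function.comp]
          exact hss _ (hD.eigenvalues_nonneg i)
        · rw [diagonal_apply_ne _ hik]
          have : E k (f ⟨i, hi⟩) = 0 := by
            simp only [hE]
            split_ifs with h1 h2
            · exact absurd (congrArg Subtype.val (f.injective h2)).symm hik
            · rfl
            · rfl
          rw [this, star_zero, mul_zero]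
      · intro j _ hj
        simp [hE, Ne.symm hj]
      · simp
    · have hi' : hD.1.eigenvalues i = 0 := not_not.1 hi
      have : ∀ j, E i j = 0 := fun j => by simp [hE, hi']
      simp only [this, zero_mul, Finset.sum_const_zero]
      by_cases hik : i = k
      · subst hik; simp [hi']
      · rw [diagonal_apply_ne _ hik]
  refine ⟨U * E, ?_⟩
  have hsp := hD.1.spectral_theorem
  rw [Unitary.conjStarAlgAut_apply] at hsp
  rw [conjTranspose_mul, Matrix.mul_assoc, ← Matrix.mul_assoc E, hEE, ← Matrix.mul_assoc]
  exact hsp.symm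

/-- A kernel vector of [X I; I Y] has the form (v, -Y⁻¹v) with (X - Y⁻¹)v = 0, so the kernel injects
into that of X - Y⁻¹. Rank-nullity in dimensions 2m and m turns this into the rank bound. -/
theorem rank_sub_inv_add_le {m : ℕ} {X Y : Matrix (Fin m) (Fin m) ℂ} (hY : Y.PosDef) :
    (X - Y⁻¹).rank + m ≤ (fromBlocks X 1 1 Y).rank := by
  have hYY : Y⁻¹ * Y = 1 :=
    Matrix.nonsing_inv_mul _ ((Matrix.isUnit_iff_isUnit_det _).1 hY.isUnit)
  set P := (fromBlocks X 1 1 Y) with hP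
  have hker : ∀ v ∈ LinearMap.ker P.mulVecLin,
      (X - Y⁻¹) *ᵥ (v ∘ Sum.inl) = 0 ∧ v ∘ Sum.inr = -(Y⁻¹ *ᵥ (v ∘ Sum.inl)) := by
    intro v hv
    rw [LinearMap.mem_ker, mulVecLin_apply, hP, fromBlocks_mulVec] at hv
    have h1 : X *ᵥ (v ∘ Sum.inl) + v ∘ Sum.inr = 0 := by
      have := congrArg (fun w => w ∘ Sum.inl) hv
      simpa using this
    have h2 : v ∘ Sum.inl + Y *ᵥ (v ∘ Sum.inr) = 0 := by
      have := congrArg (fun w => w ∘ Sum.inr) hv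
      simpa using this
    have h3 : v ∘ Sum.inr = -(Y⁻¹ *ᵥ (v ∘ Sum.inl)) := by
      have := congrArg (fun w => Y⁻¹ *ᵥ w) h2
      simp only [mulVec_add, mulVec_mulVec, hYY, one_mulVec, mulVec_zero] at this
      exact (neg_eq_of_add_eq_zero_right this).symm
    refine ⟨?_, h3⟩
    rw [sub_mulVec, sub_eq_add_neg, ← h3, h1]
  set φ : LinearMap.ker P.mulVecLin →ₗ[ℂ] LinearMap.ker (X - Y⁻¹).mulVecLin :=
    (LinearMap.funLeft ℂ ℂ (Sum.inl : Fin m → Fin m ⊕ Fin m)).restrict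
      (fun v hv => (hker v hv).1) with hφ
  have hφinj : Function.Injective φ := by
    rw [← LinearMap.ker_eq_bot, LinearMap.ker_eq_bot']
    rintro ⟨v, hv⟩ h0
    have h1 : v ∘ Sum.inl = 0 := congrArg Subtype.val h0
    have h2 := (hker v hv).2
    rw [h1, mulVec_zero, neg_zero] at h2
    ext (i | i)
    · exact congrFun h1 i
    · exact congrFun h2 i
  have h1 := LinearMap.finrank_le_finrank_of_injective hφinj
  have h2 := P.mulVecLin.finrank_range_add_finrank_ker
  have h3 := (X - Y⁻¹).mulVecLin.finrank_range_add_finrank_ker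
  rw [Module.finrank_fintype_fun_eq_card] at h2 h3
  simp only [Fintype.card_sum, Fintype.card_fin] at h2 h3
  rw [Matrix.rank, Matrix.rank]
  omega

/-- The certificate `X̂ = [X₁ V; V† I]` with `(X̂⁻¹)₁₁ = Y₁`. -/
theorem exists_completion {m r : ℕ} {X Y : Matrix (Fin m) (Fin m) ℂ} (hY : Y.PosDef)
    (h : (fromBlocks X 1 1 Y).PosSemidef) (hr : (fromBlocks X 1 1 Y).rank ≤ m + r) :
    ∃ V : Matrix (Fin m) (Fin r) ℂ, (X - V * Vᴴ) * Y = 1 ∧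
      (fromBlocks X V Vᴴ 1 : Matrix (Fin m ⊕ Fin r) (Fin m ⊕ Fin r) ℂ).PosDef := by
  have hdet := (Matrix.isUnit_iff_isUnit_det _).1 hY.isUnit
  have : Invertible Y := Matrix.invertibleOfIsUnitDet Y hdet
  have h1 : (X - Y⁻¹).PosSemidef := by
    have h' : (fromBlocks X 1 (1 : Matrix (Fin m) (Fin m) ℂ)ᴴ Y).PosSemidef := by
      rwa [conjTranspose_one]
    simpa using (PosDef.fromBlocks₂₂ X 1 hY).1 h'
  obtain ⟨V, hV⟩ := exists_mul_conjTranspose_of_rank_le (r := r) h1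
    (by have := rank_sub_inv_add_le (X := X) hY; omega)
  have h2 : X - V * Vᴴ = Y⁻¹ := by rw [hV]; abel
  refine ⟨V, by rw [h2, Matrix.nonsing_inv_mul _ hdet], posDef_fromBlocks_one ?_⟩
  rw [h2]; exact hY.inv

end completion

/-! ### Solvability of the filter inequality -/

section blocks

variable {a b c q r : Type}

theorem fromCols_add_fromCols (A C : Matrix a b ℂ) (B D : Matrix a c ℂ) :
    fromCols A B + fromCols C D = fromCols (A + C) (B + D) := by
  ext i (j | j) <;> rfl

variable [Fintype a] [Fintype b] [Fintype c]

/-- The kernel matrices of Π and of Λ share this block pattern, so a single expansion serves both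
compressions of Σ. -/
theorem blocks3_congruence (M11 : Matrix a a ℂ) (M12 : Matrix a b ℂ) (M13 : Matrix a c ℂ)
    (M21 : Matrix b a ℂ) (M22 : Matrix b b ℂ) (M23 : Matrix b c ℂ) (M31 : Matrix c a ℂ)
    (M32 : Matrix c b ℂ) (M33 : Matrix c c ℂ) (Z : Matrix a q ℂ) (E : Matrix b r ℂ)
    (N : Matrix c q ℂ) (F : Matrix c r ℂ) :
    (fromRows (fromBlocks Z 0 0 E) (fromCols N F))ᴴ *
      blocks3 M11 M12 M13 M21 M22 M23 M31 M32 M33 *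
      fromRows (fromBlocks Z 0 0 E) (fromCols N F) =
    fromBlocks (Zᴴ * M11 * Z + Zᴴ * M13 * N + Nᴴ * M31 * Z + Nᴴ * M33 * N)
      (Zᴴ * M12 * E + Zᴴ * M13 * F + Nᴴ * M32 * E + Nᴴ * M33 * F)
      (Eᴴ * M21 * Z + Eᴴ * M23 * N + Fᴴ * M31 * Z + Fᴴ * M33 * N)
      (Eᴴ * M22 * E + Eᴴ * M23 * F + Fᴴ * M32 * E + Fᴴ * M33 * F) := by
  rw [blocks3, Matrix.mul_assoc, fromBlocks_mul_fromRows, fromBlocks_multiply,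
    fromRows_mul_fromCols, fromBlocks_add, fromCols_mul_fromBlocks, mul_fromCols,
    fromCols_add_fromCols, conjTranspose_fromRows_eq_fromCols_conjTranspose,
    fromBlocks_conjTranspose, conjTranspose_fromCols_eq_fromRows_conjTranspose,
    fromCols_mul_fromRows, fromBlocks_multiply, fromRows_mul_fromCols, fromBlocks_add]
  simp only [conjTranspose_zero, Matrix.mul_zero, Matrix.zero_mul, add_zero, zero_add,
    Matrix.mul_add, Matrix.mul_assoc]
  congr 1 <;> abel

end blocks

/-! ### Compressions to the two kernels -/

namespace FactorData

variable {m n ny p m11 : ℕ} (R : FactorData m n ny p)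

theorem sigmaX_isHermitian (γbar : ℝ) {X : Matrix (Fin m ⊕ Fin m11) (Fin m ⊕ Fin m11) ℂ}
    (hX : Xᴴ = X) : (R.SigmaX γbar X).IsHermitian := by
  have hg : star ((γbar : ℂ) ^ 2) = (γbar : ℂ) ^ 2 := by
    rw [star_pow, Complex.star_def, Complex.conj_ofReal]
  rw [SigmaX, blocks3, IsHermitian, fromBlocks_conjTranspose, fromBlocks_conjTranspose,
    conjTranspose_fromRows_eq_fromCols_conjTranspose,
    conjTranspose_fromCols_eq_fromRows_conjTranspose]
  simp only [conjTranspose_add, conjTranspose_mul, conjTranspose_conjTranspose, conjTranspose_neg,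
    conjTranspose_smul, conjTranspose_one, hX, hg]
  rw [add_comm]

theorem piMat_mul_conjTranspose : PiMat m n p m11 * (PiMat m n p m11)ᴴ = 1 := by
  rw [PiMat, conjTranspose_fromCols_eq_fromRows_conjTranspose,
    conjTranspose_fromCols_eq_fromRows_conjTranspose, fromCols_mul_fromRows, fromCols_mul_fromRows,
    fromBlocks_conjTranspose, conjTranspose_fromRows_eq_fromCols_conjTranspose,
    fromBlocks_multiply, fromRows_mul_fromCols, fromBlocks_add]
  simp

/-- A basis matrix of the kernel of `Π`. -/
def piKernel (m n p m11 : ℕ) : Matrix (((Fin m ⊕ Fin m11) ⊕ Fin n) ⊕ Fin p) (Fin m ⊕ Fin p) ℂ :=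
  fromRows (fromBlocks (fromRows 1 0) 0 0 0) (fromCols 0 1)

theorem exists_piKernel (x : ((Fin m ⊕ Fin m11) ⊕ Fin n) ⊕ Fin p → ℂ)
    (hx : PiMat m n p m11 *ᵥ x = 0) : ∃ y, x = piKernel m n p m11 *ᵥ y := by
  have h2 : ∀ i, x (Sum.inl (Sum.inl (Sum.inr i))) = 0 := by
    intro i
    have := congrFun hx (Sum.inl i)
    simpa [PiMat, fromCols_mulVec, fromBlocks_mulVec] using this
  have h3 : ∀ i, x (Sum.inl (Sum.inr i)) = 0 := by
    intro i
    have := congrFun hx (Sum.inr i)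
    simpa [PiMat, fromCols_mulVec, fromBlocks_mulVec, fromRows_mulVec] using this
  refine ⟨Sum.elim (fun i => x (Sum.inl (Sum.inl (Sum.inl i)))) (fun i => x (Sum.inr i)), ?_⟩
  ext (((i | i) | i) | i) <;> simp [piKernel, fromRows_mulVec, fromCols_mulVec, fromBlocks_mulVec, h2, h3]

/-- On Ker Π only the factor state and the last block survive. The block V drops out, and the Schur
complement with respect to the last block is the Lyapunov inequality for X₁. -/
theorem piKernel_sigmaX (γbar : ℝ) {X1 : Matrix (Fin m) (Fin m) ℂ} (V : Matrix (Fin m) (Fin m11) ℂ)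
    (h : (-(R.A * X1 + X1 * R.Aᴴ + R.B * R.Bᴴ)).PosDef) :
    ((piKernel m n p m11)ᴴ * -R.SigmaX γbar (fromBlocks X1 V Vᴴ 1) * piKernel m n p m11).PosDef := by
  have h1 : (fromBlocks (-(R.A * X1 + X1 * R.Aᴴ)) (-R.B) (-R.B)ᴴ
      (1 : Matrix (Fin p) (Fin p) ℂ)).PosDef := by
    refine posDef_fromBlocks_one ?_
    convert h using 1
    rw [conjTranspose_neg, Matrix.neg_mul, Matrix.mul_neg]; abel
  convert h1 using 1
  rw [piKernel, SigmaX, Matrix.mul_neg, Matrix.neg_mul, blocks3_congruence, fromBlocks_neg, Abar,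
    Cbar, conjTranspose_fromRows_eq_fromCols_conjTranspose, fromBlocks_conjTranspose,
    fromBlocks_multiply, fromBlocks_multiply, fromBlocks_add, fromCols_mul_fromBlocks,
    fromCols_mul_fromRows, conjTranspose_fromCols_eq_fromRows_conjTranspose, fromCols_mul_fromRows,
    Matrix.mul_assoc (1 : Matrix (Fin p) (Fin p) ℂ)ᴴ, fromCols_mul_fromRows]
  simp

/-- A basis matrix of the kernel of `Λ`. -/
def lambdaKernel {q : ℕ} (n : ℕ) (Y1 : Matrix (Fin m) (Fin m) ℂ) (V : Matrix (Fin m) (Fin m11) ℂ)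
    (Nc : Matrix (Fin m ⊕ Fin p) (Fin q) ℂ) :
    Matrix (((Fin m ⊕ Fin m11) ⊕ Fin n) ⊕ Fin p) (Fin q ⊕ Fin n) ℂ :=
  fromRows (fromBlocks (fromRows (Y1 * Nc.toRows₁) (-(Vᴴ * (Y1 * Nc.toRows₁)))) 0 0 1)
    (fromCols Nc.toRows₂ 0)

theorem completion_mul {q : ℕ} {X1 Y1 : Matrix (Fin m) (Fin m) ℂ} {V : Matrix (Fin m) (Fin m11) ℂ}
    (h : (X1 - V * Vᴴ) * Y1 = 1) (N : Matrix (Fin m) (Fin q) ℂ) :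
    fromBlocks X1 V Vᴴ 1 * fromRows (Y1 * N) (-(Vᴴ * (Y1 * N))) = fromRows N 0 := by
  rw [fromBlocks_mul_fromRows]
  congr 1
  · calc X1 * (Y1 * N) + V * -(Vᴴ * (Y1 * N)) = ((X1 - V * Vᴴ) * Y1) * N := by
          simp only [Matrix.sub_mul, Matrix.mul_neg, Matrix.mul_assoc]; abel
      _ = N := by rw [h, Matrix.one_mul]
  · simp

/-- In the variable e = X̂x the equation says that the second part of e vanishes and that (e₁, w)
lies in Ker [C₁ D₁]. Undoing X̂ uses the first block column (Y₁, -V†Y₁) of its inverse; the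
component u is unconstrained. -/
theorem exists_lambdaKernel {q : ℕ} {X1 Y1 : Matrix (Fin m) (Fin m) ℂ}
    {V : Matrix (Fin m) (Fin m11) ℂ} (hXY : (X1 - V * Vᴴ) * Y1 = 1)
    (hX : (fromBlocks X1 V Vᴴ (1 : Matrix (Fin m11) (Fin m11) ℂ)).PosDef)
    {Nc : Matrix (Fin m ⊕ Fin p) (Fin q) ℂ} (hNc : R.IsKernelBasis Nc)
    (x : ((Fin m ⊕ Fin m11) ⊕ Fin n) ⊕ Fin p → ℂ)
    (hx : R.LambdaX (fromBlocks X1 V Vᴴ 1) *ᵥ x = 0) : ∃ y, x = lambdaKernel n Y1 V Nc *ᵥ y := by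
  set X : Matrix (Fin m ⊕ Fin m11) (Fin m ⊕ Fin m11) ℂ := fromBlocks X1 V Vᴴ 1 with hXdef
  obtain ⟨x1, u, w, rfl⟩ : ∃ x1 u w, x = Sum.elim (Sum.elim x1 u) w :=
    ⟨(x ∘ Sum.inl) ∘ Sum.inl, (x ∘ Sum.inl) ∘ Sum.inr, x ∘ Sum.inr, by
      simp only [Sum.elim_comp_inl_inr]⟩
  set e := X *ᵥ x1 with he
  have h1 : (R.Bund m11)ᴴ *ᵥ e + (R.D12und m11)ᴴ *ᵥ w = 0 := by
    rw [LambdaX, fromCols_mulVec, Sum.elim_comp_inl, Sum.elim_comp_inr, fromCols_mulVec,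
      Sum.elim_comp_inl, zero_mulVec, add_zero, ← mulVec_mulVec] at hx
    exact hx
  rw [Bund, D12und, fromBlocks_conjTranspose, conjTranspose_fromCols_eq_fromRows_conjTranspose,
    fromBlocks_mulVec, fromRows_mulVec] at h1
  have he2 : e ∘ Sum.inr = 0 := by
    have := congrArg (fun v => v ∘ Sum.inl) h1
    ext i
    simpa using congrFun this i
  have he1 : fromCols R.C1 R.D1 *ᵥ Sum.elim (e ∘ Sum.inl) w = 0 := by
    have := congrArg (fun v => v ∘ Sum.inr) h1
    rw [fromCols_mulVec, Sum.elim_comp_inl, Sum.elim_comp_inr]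
    ext i
    simpa using congrFun this i
  have hmem : Sum.elim (e ∘ Sum.inl) w ∈ LinearMap.range Nc.mulVecLin := by
    rw [hNc.2]; exact he1
  obtain ⟨t, ht⟩ := hmem
  rw [mulVecLin_apply, ← fromRows_toRows Nc, fromRows_mulVec] at ht
  have ht1 : Nc.toRows₁ *ᵥ t = e ∘ Sum.inl := congrArg (fun v => v ∘ Sum.inl) ht
  have ht2 : Nc.toRows₂ *ᵥ t = w := congrArg (fun v => v ∘ Sum.inr) ht
  refine ⟨Sum.elim t u, ?_⟩
  have hZ : X *ᵥ (fromRows (Y1 * Nc.toRows₁) (-(Vᴴ * (Y1 * Nc.toRows₁))) *ᵥ t) = X *ᵥ x1 := by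
    rw [mulVec_mulVec, completion_mul hXY, fromRows_mulVec, ht1, zero_mulVec, ← he]
    ext (i | i)
    · rfl
    · exact (congrFun he2 i).symm
  have hZ' := mulVec_injective_of_isUnit hX.isUnit hZ
  rw [lambdaKernel, fromRows_mulVec, fromBlocks_mulVec, fromCols_mulVec_sumElim,
    Sum.elim_comp_inl, Sum.elim_comp_inr, zero_mulVec, zero_mulVec, zero_mulVec,
    add_zero, add_zero, zero_add, one_mulVec, ht2, hZ']

/-- The state part Z of the kernel matrix satisfies X̂Z = [N₁; 0], with N₁ the upper rows of the
kernel basis. Every X̂ is absorbed by an adjacent Z, so that only Y₁ is left. -/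
theorem lambdaKernel_sigmaX {q : ℕ} (γbar : ℝ) {X1 Y1 : Matrix (Fin m) (Fin m) ℂ}
    {V : Matrix (Fin m) (Fin m11) ℂ} (hXY : (X1 - V * Vᴴ) * Y1 = 1) (hX1 : X1ᴴ = X1)
    (hY1 : Y1ᴴ = Y1) (Nc : Matrix (Fin m ⊕ Fin p) (Fin q) ℂ) :
    (lambdaKernel n Y1 V Nc)ᴴ * R.SigmaX γbar (fromBlocks X1 V Vᴴ 1) * lambdaKernel n Y1 V Nc =
      (fromBlocks Nc 0 0 (1 : Matrix (Fin n) (Fin n) ℂ))ᴴ *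
      blocks3
        (R.Aᴴ * Y1 + Y1 * R.A) (Y1 * R.B) R.C2ᴴ
        (R.Bᴴ * Y1) (-1) R.D2ᴴ
        R.C2 R.D2 (-(((γbar : ℂ) ^ 2) • 1)) *
      fromBlocks Nc 0 0 (1 : Matrix (Fin n) (Fin n) ℂ) := by
  set X : Matrix (Fin m ⊕ Fin m11) (Fin m ⊕ Fin m11) ℂ := fromBlocks X1 V Vᴴ 1 with hXdef
  have hXH : Xᴴ = X := by
    rw [hXdef, fromBlocks_conjTranspose, hX1, conjTranspose_conjTranspose, conjTranspose_one]
  set N1 := Nc.toRows₁ with hN1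
  set N2 := Nc.toRows₂ with hN2
  have hN : Nc = fromRows N1 N2 := (fromRows_toRows Nc).symm
  set Z : Matrix (Fin m ⊕ Fin m11) (Fin q) ℂ := fromRows (Y1 * N1) (-(Vᴴ * (Y1 * N1))) with hZ
  have hXZ : X * Z = fromRows N1 0 := completion_mul hXY N1
  have hZX : Zᴴ * X = fromCols N1ᴴ 0 := by
    have := congrArg conjTranspose hXZ
    rwa [conjTranspose_mul, hXH, conjTranspose_fromRows_eq_fromCols_conjTranspose N1,
      conjTranspose_zero] at this
  have hAZ : R.Abar m11 * Z = fromRows (R.Aᴴ * (Y1 * N1)) 0 := by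
    rw [Abar, hZ, fromBlocks_mul_fromRows]; simp
  have hZA : Zᴴ * (R.Abar m11)ᴴ = fromCols (N1ᴴ * Y1 * R.A) 0 := by
    rw [← conjTranspose_mul, hAZ, conjTranspose_fromRows_eq_fromCols_conjTranspose,
      conjTranspose_mul, conjTranspose_mul, conjTranspose_conjTranspose, conjTranspose_zero, hY1]
  have hCZ : R.Cbar m11 * Z = R.Bᴴ * (Y1 * N1) := by
    rw [Cbar, hZ, fromCols_mul_fromRows]; simp
  have hZC : Zᴴ * (R.Cbar m11)ᴴ = N1ᴴ * Y1 * R.B := by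
    rw [← conjTranspose_mul, hCZ, conjTranspose_mul, conjTranspose_mul, conjTranspose_conjTranspose,
      hY1]
  have e1 : Zᴴ * ((R.Abar m11)ᴴ * X + X * R.Abar m11) * Z =
      N1ᴴ * (R.Aᴴ * Y1 + Y1 * R.A) * N1 := by
    calc Zᴴ * ((R.Abar m11)ᴴ * X + X * R.Abar m11) * Z
        = (Zᴴ * (R.Abar m11)ᴴ) * (X * Z) + (Zᴴ * X) * (R.Abar m11 * Z) := by
          simp only [Matrix.mul_add, Matrix.add_mul, Matrix.mul_assoc]
      _ = _ := by
          rw [hZA, hXZ, hZX, hAZ, fromCols_mul_fromRows, fromCols_mul_fromRows]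
          simp only [Matrix.mul_add, Matrix.add_mul, Matrix.mul_assoc, Matrix.zero_mul, add_zero]
          abel
  have e2 : Zᴴ * (X * R.Bbar m11) = N1ᴴ * R.C2ᴴ := by
    rw [← Matrix.mul_assoc, hZX, Bbar, fromCols_mul_fromRows]; simp
  have e3 : (R.Bbar m11)ᴴ * X * Z = R.C2 * N1 := by
    rw [Matrix.mul_assoc, hXZ, Bbar, conjTranspose_fromRows_eq_fromCols_conjTranspose,
      fromCols_mul_fromRows]; simp
  have rhs : (fromBlocks Nc 0 0 (1 : Matrix (Fin n) (Fin n) ℂ))ᴴ *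
      blocks3 (R.Aᴴ * Y1 + Y1 * R.A) (Y1 * R.B) R.C2ᴴ (R.Bᴴ * Y1) (-1) R.D2ᴴ
        R.C2 R.D2 (-(((γbar : ℂ) ^ 2) • 1)) * fromBlocks Nc 0 0 (1 : Matrix (Fin n) (Fin n) ℂ) =
      fromBlocks (N1ᴴ * (R.Aᴴ * Y1 + Y1 * R.A) * N1 + N2ᴴ * (R.Bᴴ * Y1) * N1
          + (N1ᴴ * (Y1 * R.B) * N2 - N2ᴴ * N2))
        (N1ᴴ * R.C2ᴴ + N2ᴴ * R.D2ᴴ) (R.C2 * N1 + R.D2 * N2) (-(((γbar : ℂ) ^ 2) • 1)) := by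
    rw [blocks3, fromBlocks_conjTranspose, fromBlocks_multiply, fromBlocks_multiply, hN,
      conjTranspose_fromRows_eq_fromCols_conjTranspose]
    simp only [conjTranspose_zero, conjTranspose_one, Matrix.mul_zero, Matrix.zero_mul, add_zero,
      zero_add, Matrix.one_mul, Matrix.mul_one, fromCols_mul_fromBlocks, fromCols_mul_fromRows]
    congr 1
    simp only [Matrix.add_mul, Matrix.mul_neg, Matrix.neg_mul, Matrix.mul_one]
    abel
  rw [rhs, lambdaKernel, SigmaX, Dbar, ← hN1, ← hN2, ← hZ, blocks3_congruence, e1]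
  clear_value Z X N1 N2
  simp only [conjTranspose_zero, conjTranspose_one, Matrix.mul_zero, Matrix.zero_mul, add_zero,
    zero_add, Matrix.one_mul, Matrix.mul_one, e2, e3, hZC, conjTranspose_conjTranspose]
  congr 1
  rw [Matrix.mul_assoc N2ᴴ, hCZ]
  simp only [Matrix.mul_assoc, Matrix.mul_neg, Matrix.neg_mul, Matrix.one_mul]
  abel

variable {R}

theorem exists_filterLMI {q : ℕ} {lam γbar : ℝ} {Nc : Matrix (Fin m ⊕ Fin p) (Fin q) ℂ}
    (hNc : R.IsKernelBasis Nc) {X1 Y1 : Matrix (Fin m) (Fin m) ℂ}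
    (h : R.SatisfiesLMIs lam Nc γbar X1 Y1) (hr : (fromBlocks X1 1 1 Y1).rank ≤ m + m11) :
    ∃ (F : FilterData m11 n ny) (X : Matrix (Fin m ⊕ Fin m11) (Fin m ⊕ Fin m11) ℂ),
      R.FilterLMI γbar F X := by
  obtain ⟨-, hX1, hY1, hA, hB, hXY⟩ := h
  obtain ⟨V, hV, hpos⟩ := exists_completion hY1 hXY hr
  have hW : ((lambdaKernel n Y1 V Nc)ᴴ * -R.SigmaX γbar (fromBlocks X1 V Vᴴ 1) *
      lambdaKernel n Y1 V Nc).PosDef := by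
    rw [Matrix.mul_neg, Matrix.neg_mul, R.lambdaKernel_sigmaX γbar hV hX1.1 hY1.1 Nc]
    exact hB
  obtain ⟨K, hK⟩ := projection_lemma (R.sigmaX_isHermitian γbar hpos.1).neg
    (piMat_mul_conjTranspose (m := m) (n := n) (p := p) (m11 := m11))
    (R.piKernel_sigmaX γbar V hA) exists_piKernel hW (R.exists_lambdaKernel hV hpos hNc)
  -- The projection lemma is applied to -Σ, so the filter matrix is -K. The adjoints undo those in
  -- the definition of `FilterData.K`, and the order of the off-diagonal blocks is exchanged
  -- accordingly.
  refine ⟨⟨-(K.toBlocks₁₁)ᴴ, -(K.toBlocks₂₁)ᴴ, -(K.toBlocks₁₂)ᴴ, -(K.toBlocks₂₂)ᴴ⟩,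
    fromBlocks X1 V Vᴴ 1, hpos, ?_⟩
  have hF : FilterData.K (n := n) (ny := ny) ⟨-(K.toBlocks₁₁)ᴴ, -(K.toBlocks₂₁)ᴴ,
      -(K.toBlocks₁₂)ᴴ, -(K.toBlocks₂₂)ᴴ⟩ = -K := by
    conv_rhs => rw [← fromBlocks_toBlocks K]
    simp [FilterData.K, fromBlocks_neg]
  rw [hF]
  convert hK using 1
  simp only [conjTranspose_neg, Matrix.mul_neg, Matrix.neg_mul]
  abel

end FactorData

/-! ### Spectral factorization on the closed imaginary axis -/

theorem polyParaConj_X_sub_C (z : ℂ) :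
    polyParaConj (Polynomial.X - Polynomial.C z) = -(Polynomial.X + Polynomial.C (star z)) := by
  simp [polyParaConj]; ring

theorem polyParaConj_eval_axis (q : Polynomial ℂ) (ω : ℝ) :
    (polyParaConj q).eval (Complex.I * (ω : ℂ)) = star (q.eval (Complex.I * (ω : ℂ))) := by
  rw [polyParaConj_eval, neg_star_I_mul]

theorem eq_I_mul_of_re_eq_zero {z : ℂ} (hz : z.re = 0) : z = Complex.I * (z.im : ℂ) := by
  apply Complex.ext <;> simp [hz]

/-- A polynomial which is positive on the imaginary axis has a spectral factor. -/
theorem exists_polynomial_spectral_factor (c : Polynomial ℂ) (hc : polyParaConj c = c)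
    (hpos : ∀ ω : ℝ, 0 < c.eval (Complex.I * (ω : ℂ))) :
    ∃ e : Polynomial ℂ, c = e * polyParaConj e := by
  induction hd : c.natDegree using Nat.strong_induction_on generalizing c with
  | _ d ih =>
  by_cases hdeg : c.degree = 0
  · obtain ⟨k, rfl⟩ : ∃ k, c = Polynomial.C k := ⟨_, Polynomial.eq_C_of_degree_eq_zero hdeg⟩
    have hk : 0 < k := by simpa using hpos 0
    have hk' := Complex.pos_iff.1 hk
    refine ⟨Polynomial.C (Real.sqrt k.re : ℂ), ?_⟩
    have : polyParaConj (Polynomial.C (Real.sqrt k.re : ℂ)) = Polynomial.C (Real.sqrt k.re : ℂ) := by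
      simp [polyParaConj]
    rw [this, ← Polynomial.C_mul, ← Complex.ofReal_mul, Real.mul_self_sqrt hk'.1.le]
    congr 1
    apply Complex.ext <;> simp [hk'.2]
  · obtain ⟨z, hz⟩ := Complex.exists_root (f := c) (by
      have hc0 : c ≠ 0 := by rintro rfl; simpa using hpos 0
      exact lt_of_le_of_ne (Polynomial.zero_le_degree_iff.2 hc0) (Ne.symm hdeg))
    have hzre : z.re ≠ 0 := by
      intro h
      have := hpos z.im
      rw [← eq_I_mul_of_re_eq_zero h, hz] at this
      exact lt_irrefl _ this
    -- Roots of a para-Hermitian polynomial are symmetric about the imaginary axis. Positivity keeps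
    -- them off the axis, so z and -z* are distinct and can be removed together.
    have hz' : c.IsRoot (-star z) := by
      have : (polyParaConj c).eval (-star z) = 0 := by
        rw [polyParaConj_eval]; simp [show c.eval z = 0 from hz]
      rwa [hc] at this
    obtain ⟨c1, hc1⟩ := Polynomial.dvd_iff_isRoot.2 hz
    have hne : -star z - z ≠ 0 := by
      intro h
      have := congrArg Complex.re h
      simp at this
      exact hzre (by linarith)
    have hroot1 : c1.IsRoot (-star z) := by
      rw [hc1] at hz'
      have := Polynomial.root_mul.1 hz'
      rcases this with h | h
      · simp only [Polynomial.IsRoot, Polynomial.eval_sub, Polynomial.eval_X,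
          Polynomial.eval_C] at h
        exact absurd h hne
      · exact h
    obtain ⟨c2, hc2⟩ := Polynomial.dvd_iff_isRoot.2 hroot1
    set ℓ : Polynomial ℂ := Polynomial.X - Polynomial.C z with hℓ
    have hℓ' : polyParaConj ℓ = -(Polynomial.X - Polynomial.C (-star z)) := by
      rw [hℓ, polyParaConj_X_sub_C]; simp
    -- On the axis ℓℓ^H is |ℓ|², so positivity passes to the remaining factor. The sign is that of
    -- ℓ^H = -(s + z*).
    have hfac : c = ℓ * polyParaConj ℓ * (-c2) := by
      rw [hc1, hc2, hℓ']; ring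
    have hℓ0 : ℓ ≠ 0 := Polynomial.X_sub_C_ne_zero z
    have hℓ0' : polyParaConj ℓ ≠ 0 := by
      rw [hℓ']; exact neg_ne_zero.2 (Polynomial.X_sub_C_ne_zero _)
    have hc2' : polyParaConj (-c2) = -c2 := by
      have h := hc
      conv_rhs at h => rw [hfac]
      rw [hfac, map_mul, map_mul, polyParaConj_involutive, mul_comm (polyParaConj ℓ) ℓ] at h
      exact mul_left_cancel₀ (mul_ne_zero hℓ0 hℓ0') h
    have hc0 : c ≠ 0 := by rintro rfl; simpa using hpos 0
    have hc20 : -c2 ≠ 0 := by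
      intro h; rw [h, mul_zero] at hfac; exact hc0 hfac
    have hdeg2 : (-c2).natDegree < d := by
      rw [← hd]
      conv_rhs => rw [hfac, Polynomial.natDegree_mul (mul_ne_zero hℓ0 hℓ0') hc20,
        Polynomial.natDegree_mul hℓ0 hℓ0', hℓ, Polynomial.natDegree_X_sub_C]
      omega
    obtain ⟨e, he⟩ := ih _ hdeg2 (-c2) hc2' (fun ω => by
      have h := hpos ω
      rw [hfac, Polynomial.eval_mul, Polynomial.eval_mul, polyParaConj_eval_axis] at h
      have hn : 0 ≤ ℓ.eval (Complex.I * (ω : ℂ)) * star (ℓ.eval (Complex.I * (ω : ℂ))) :=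
        mul_star_self_nonneg _
      have hn' := lt_of_le_of_ne hn (by
        intro h0; rw [← h0, zero_mul] at h; exact lt_irrefl _ h)
      exact (pos_iff_pos_of_mul_pos h).1 hn') rfl
    refine ⟨ℓ * e, ?_⟩
    rw [map_mul]
    calc c = ℓ * polyParaConj ℓ * (-c2) := hfac
      _ = _ := by rw [he]; ring

/-- A rational function which is positive on the closed imaginary axis is `h h^H`, where `h` and
`1/h` are proper and have no poles on the axis. -/
theorem exists_scalar_spectral_factor {a : RatFunc ℂ} (ha : a ∈ axisRing) (hstar : star a = a)
    (hpos : ∀ ω : ℝ, 0 < ev (Complex.I * (ω : ℂ)) a)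
    (hinf : a.num.coeff a.denom.natDegree ≠ 0) :
    ∃ h : RatFunc ℂ, h ∈ axisRing ∧ h⁻¹ ∈ axisRing ∧ h ≠ 0 ∧ a = h * star h := by
  obtain ⟨hprop, hreg⟩ := mem_axisRing.1 ha
  set N := a.num with hN
  set D := a.denom with hD
  have hD0 : D ≠ 0 := a.denom_ne_zero
  have hD0' : polyParaConj D ≠ 0 := nonZeroDivisors.ne_zero
    (polyParaConj_nonZeroDivisors (mem_nonZeroDivisors_of_ne_zero hD0))
  have haD : a = algebraMap _ (RatFunc ℂ) N / algebraMap _ (RatFunc ℂ) D :=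
    (RatFunc.num_div_denom a).symm
  have hdegND : N.natDegree = D.natDegree :=
    le_antisymm (mem_properRing_iff.1 hprop) (Polynomial.le_natDegree_of_ne_zero hinf)
  have hN0 : N ≠ 0 := by
    intro h; rw [h] at hinf; simp at hinf
  have hDax : ∀ ω : ℝ, D.eval (Complex.I * (ω : ℂ)) ≠ 0 := fun ω => hreg ω
  have hA : Function.Injective (algebraMap (Polynomial ℂ) (RatFunc ℂ)) :=
    RatFunc.algebraMap_injective ℂ
  have hcross : polyParaConj N * D = N * polyParaConj D := by
    have h := hstar
    rw [star_ratFunc, ratParaConj_apply, ← hN, ← hD] at h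
    conv_rhs at h => rw [haD]
    rw [div_eq_div_iff (RatFunc.algebraMap_ne_zero hD0') (RatFunc.algebraMap_ne_zero hD0),
      ← map_mul, ← map_mul] at h
    exact hA h
  -- On the axis c = a|D|², so c is positive there; a = c/(DD^H), and c = ee^H gives the factor h =
  -- e/D.
  set c := N * polyParaConj D with hc
  have hcc : polyParaConj c = c := by
    rw [hc, map_mul, polyParaConj_involutive, hcross]
  have hcpos : ∀ ω : ℝ, 0 < c.eval (Complex.I * (ω : ℂ)) := by
    intro ω
    have h := hpos ω
    rw [ev_eq_div, ← hN, ← hD] at h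
    rw [hc, Polynomial.eval_mul, polyParaConj_eval_axis]
    have h1 : N.eval (Complex.I * (ω : ℂ)) = N.eval (Complex.I * (ω : ℂ)) /
        D.eval (Complex.I * (ω : ℂ)) * D.eval (Complex.I * (ω : ℂ)) :=
      (div_mul_cancel₀ _ (hDax ω)).symm
    rw [h1, mul_assoc]
    refine mul_pos h (lt_of_le_of_ne (mul_star_self_nonneg _) (Ne.symm ?_))
    exact mul_ne_zero (hDax ω) (star_ne_zero.2 (hDax ω))
  obtain ⟨e, he⟩ := exists_polynomial_spectral_factor c hcc hcpos
  have heax : ∀ ω : ℝ, e.eval (Complex.I * (ω : ℂ)) ≠ 0 := by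
    intro ω h
    have := hcpos ω
    rw [he, Polynomial.eval_mul, h, zero_mul] at this
    exact lt_irrefl _ this
  have he0 : e ≠ 0 := by
    rintro rfl; simpa using heax 0
  have he0' : polyParaConj e ≠ 0 := nonZeroDivisors.ne_zero
    (polyParaConj_nonZeroDivisors (mem_nonZeroDivisors_of_ne_zero he0))
  -- The nonzero value of a at infinity forces deg N = deg D, hence deg e = deg D. This makes both h
  -- and 1/h proper.
  have hdege : e.natDegree = D.natDegree := by
    have h := congrArg Polynomial.natDegree he
    rw [hc, Polynomial.natDegree_mul hN0 hD0', Polynomial.natDegree_mul he0 he0',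
      natDegree_polyParaConj, natDegree_polyParaConj] at h
    omega
  refine ⟨algebraMap _ (RatFunc ℂ) e / algebraMap _ (RatFunc ℂ) D,
    mem_axisRing.2 ⟨div_mem_properRing hdege.le, fun ω => div_mem_regularAt _ (hDax ω)⟩, ?_,
    div_ne_zero (RatFunc.algebraMap_ne_zero he0) (RatFunc.algebraMap_ne_zero hD0), ?_⟩
  · rw [inv_div]
    exact mem_axisRing.2 ⟨div_mem_properRing hdege.ge, fun ω => div_mem_regularAt _ (heax ω)⟩
  · rw [star_div₀, star_algebraMap, star_algebraMap, div_mul_div_comm, ← map_mul, ← map_mul, ← he,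
      hc, map_mul, map_mul, mul_div_mul_right _ _ (RatFunc.algebraMap_ne_zero hD0'), ← haD]

/-- The Schur complement step. The columns of T form a basis of Ker ν†, which exists in this graph
form because |ν₀|² = V₀₀ > 0; compressing V by T kills νν† and leaves the lower block of Z. -/
theorem posDef_submatrix_succ_of_rank_one {n : ℕ} {V : Matrix (Fin (n + 1)) (Fin (n + 1)) ℂ}
    (hV : V.PosDef) {ν : Matrix (Fin (n + 1)) (Fin 1) ℂ} {Z : Matrix (Fin (n + 1)) (Fin (n + 1)) ℂ}
    (hZ : V = ν * νᴴ + Z) (hcol : ∀ i, Z i 0 = 0) (hrow : ∀ j, Z 0 j = 0) :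
    (Z.submatrix Fin.succ Fin.succ).PosDef := by
  have hν : star (ν 0 0) ≠ 0 := by
    intro h
    have h1 := hV.diag_pos (i := 0)
    rw [hZ] at h1
    simp [Matrix.mul_apply, hcol, star_eq_zero.1 h] at h1
  set T : Matrix (Fin (n + 1)) (Fin n) ℂ :=
    Matrix.of (Fin.cons (fun j => -(star (ν j.succ 0) / star (ν 0 0)))
      (fun i j => if i = j then 1 else 0)) with hT
  have hT0 : ∀ j, T 0 j = -(star (ν j.succ 0) / star (ν 0 0)) := fun j => rfl
  have hTs : ∀ i j, T (Fin.succ i) j = if i = j then 1 else 0 := fun i j => rfl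
  clear_value T
  have hνT : νᴴ * T = 0 := by
    ext i j
    fin_cases i
    simp only [Matrix.mul_apply, Fin.sum_univ_succ, hT0, hTs, conjTranspose_apply, mul_ite, mul_one,
      mul_zero, Finset.sum_ite_eq', Finset.mem_univ, if_true, Matrix.zero_apply, mul_neg,
      Fin.zero_eta]
    rw [mul_div_cancel₀ _ hν, neg_add_cancel]
  have hTZ : Tᴴ * Z * T = Z.submatrix Fin.succ Fin.succ := by
    ext i j
    simp [Matrix.mul_apply, Fin.sum_univ_succ, hTs, hcol, hrow]
  have hinj : Function.Injective T.mulVec := by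
    intro x y hxy
    ext i
    have h := congrFun hxy i.succ
    simpa [Matrix.mulVec, dotProduct, hTs] using h
  have h := hV.conjTranspose_mul_mul_same hinj
  rw [hZ, Matrix.mul_add, Matrix.add_mul, Matrix.mul_assoc, Matrix.mul_assoc ν, hνT, Matrix.mul_zero,
    Matrix.mul_zero, zero_add, hTZ] at h
  exact h

/-- Spectral factorization of a transfer matrix which is positive definite on the closed axis. -/
theorem exists_matrix_spectral_factor {n : ℕ} (M : TransferMatrix (Fin n) (Fin n))
    (hM : EntriesIn axisRing M) (hstar : Mᴴ = M)
    (hpos : ∀ l, IsAxisFilter l → ∀ V, Tendsto (freq M) l (𝓝 V) → V.PosDef) :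
    ∃ (r : ℕ) (W : TransferMatrix (Fin n) (Fin r)), EntriesIn axisRing W ∧ M = W * Wᴴ := by
  induction n with
  | zero => exact ⟨0, 0, fun i => i.elim0, Subsingleton.elim _ _⟩
  | succ n ih =>
    have hentry : ∀ i j, star (M j i) = M i j := fun i j => congrFun (congrFun hstar i) j
    obtain ⟨h, hh, hinv, h0, ha⟩ := exists_scalar_spectral_factor (hM 0 0) (hentry 0 0)
      (fun ω => (hpos _ (Or.inl ⟨ω, rfl⟩) _ (tendsto_pure_nhds _ _)).diag_pos (i := 0)) (by
        obtain ⟨V, hV⟩ := exists_tendsto_freq (Or.inr rfl) hM.proper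
        have h1 := (hpos _ (Or.inr rfl) V hV).diag_pos (i := 0)
        rw [tendsto_nhds_unique (tendsto_pi_nhds.1 (tendsto_pi_nhds.1 hV 0) 0)
          (tendsto_ev_cocompact (hM.proper 0 0))] at h1
        exact h1.ne')
    have hs0 : star h ≠ 0 := star_ne_zero.2 h0
    -- One Cholesky step: the first column of M divided by h^H. Since M₀₀ = hh^H, the top entry of v
    -- is h and M - vv^H has zero first row and column. Regularity of 1/h keeps v proper and free of
    -- poles on the axis.
    set v : TransferMatrix (Fin (n + 1)) (Fin 1) := Matrix.of fun i _ => M i 0 * star h⁻¹ with hv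
    have hvapp : ∀ i j, v i j = M i 0 * star h⁻¹ := fun _ _ => rfl
    have hvax : EntriesIn axisRing v := fun i _ => mul_mem (hM i 0) (star_mem_axisRing hinv)
    have hv0 : ∀ j, v 0 j = h := fun j => by
      rw [hvapp, ha, star_inv₀, mul_inv_cancel_right₀ hs0]
    set N : TransferMatrix (Fin (n + 1)) (Fin (n + 1)) := M - v * vᴴ with hN
    have hNax : EntriesIn axisRing N := hM.sub (hvax.mul hvax.conjTranspose)
    have hNstar : Nᴴ = N := by
      rw [hN, conjTranspose_sub, hstar, conjTranspose_mul, conjTranspose_conjTranspose]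
    have hcol : ∀ i, N i 0 = 0 := fun i => by
      rw [hN, Matrix.sub_apply, Matrix.mul_apply, Fin.sum_univ_one, conjTranspose_apply, hv0, hvapp,
        star_inv₀, inv_mul_cancel_right₀ hs0, sub_self]
    have hrow : ∀ j, N 0 j = 0 := fun j => by
      rw [← hNstar, conjTranspose_apply, hcol, star_zero]
    have hMN : M = v * vᴴ + N := by rw [hN]; abel
    clear_value N v
    obtain ⟨r, W, hW, hWN⟩ := ih (N.submatrix Fin.succ Fin.succ) (fun i j => hNax _ _)
      (by rw [conjTranspose_submatrix, hNstar]) (by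
        intro l hl V hV
        have := hl.neBot
        obtain ⟨ν, hν⟩ := exists_tendsto_freq hl hvax.proper
        obtain ⟨Z, hZ⟩ := exists_tendsto_freq hl hNax.proper
        obtain ⟨U, hU⟩ := exists_tendsto_freq hl hM.proper
        have hVZ : V = Z.submatrix Fin.succ Fin.succ := by
          refine tendsto_nhds_unique hV ?_
          exact tendsto_pi_nhds.2 fun i => tendsto_pi_nhds.2 fun j =>
            tendsto_pi_nhds.1 (tendsto_pi_nhds.1 hZ _) _
        have hzero : ∀ i j, N i j = 0 → Z i j = 0 := fun i j hij => by
          refine tendsto_nhds_unique (tendsto_pi_nhds.1 (tendsto_pi_nhds.1 hZ i) j) ?_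
          simp only [freq, evalAt, map_apply, hij, RatFunc.eval_zero]
          exact tendsto_const_nhds
        have hUZ : U = ν * νᴴ + Z := by
          refine tendsto_nhds_unique hU ?_
          rw [hMN, show freq (v * vᴴ + N) = fun ω => freq (v * vᴴ) ω + freq N ω from
            funext (freq_add (hvax.mul hvax.conjTranspose) hNax)]
          exact (tendsto_freq_mul hvax hvax.conjTranspose hν
            (tendsto_freq_conjTranspose hvax hν)).add hZ
        rw [hVZ]
        exact posDef_submatrix_succ_of_rank_one (hpos l hl U hU) hUZ
          (fun i => hzero i 0 (hcol i)) (fun j => hzero 0 j (hrow j)))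
    set W0 : TransferMatrix (Fin (n + 1)) (Fin r) := Matrix.of (Fin.cons 0 W) with hW0
    have hz : ∀ j, W0 0 j = 0 := fun j => rfl
    have hs : ∀ i j, W0 (Fin.succ i) j = W i j := fun i j => rfl
    clear_value W0
    have hW0ax : EntriesIn axisRing W0 := by
      intro i j
      refine Fin.cases ?_ (fun i => ?_) i
      · rw [hz]; exact zero_mem _
      · rw [hs]; exact hW i j
    have hNW : N = W0 * W0ᴴ := by
      ext i j
      refine Fin.cases ?_ (fun i => ?_) i
      · rw [hrow]; simp [Matrix.mul_apply, hz]
      refine Fin.cases ?_ (fun j => ?_) j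
      · rw [hcol]; simp [Matrix.mul_apply, hz]
      · have := congrFun (congrFun hWN i) j
        rw [submatrix_apply] at this
        rw [this]
        simp [Matrix.mul_apply, hs]
    refine ⟨1 + r, (fromCols v W0).submatrix id finSumFinEquiv.symm,
      fun i j => (hvax.fromCols hW0ax) _ _, ?_⟩
    rw [conjTranspose_submatrix, submatrix_mul_equiv, submatrix_id_id,
      conjTranspose_fromCols_eq_fromRows_conjTranspose, fromCols_mul_fromRows, ← hNW]
    exact hMN

/-! ### Inner multipliers and paraunitary completion -/

theorem inv_X_sub_C_mem_regularAt {z s : ℂ} (h : s ≠ z) :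
    (algebraMap (Polynomial ℂ) (RatFunc ℂ) (Polynomial.X - Polynomial.C z))⁻¹ ∈ regularAt s := by
  have := div_mem_regularAt (s := s) 1 (q := Polynomial.X - Polynomial.C z)
    (by simpa [sub_eq_zero] using h)
  simpa using this

/-- b is a Blaschke product: each root z on the right contributes (s - z)/(s + z*), which is stable,
of modulus one on the axis, and cancels the factor s - z of Q. Roots on the left need no correction.
-/
theorem exists_inner_div_regular (Q : Polynomial ℂ)
    (hQ : ∀ ω : ℝ, Q.eval (Complex.I * (ω : ℂ)) ≠ 0) :
    ∃ b ∈ stableRing, b * star b = 1 ∧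
      ∀ s : ℂ, 0 ≤ s.re → b * (algebraMap (Polynomial ℂ) (RatFunc ℂ) Q)⁻¹ ∈ regularAt s := by
  have hQ0 : Q ≠ 0 := by rintro rfl; simpa using hQ 0
  induction hd : Q.natDegree generalizing Q with
  | zero =>
    refine ⟨1, one_mem _, by simp, fun s _ => ?_⟩
    have := div_mem_regularAt (s := s) 1 (q := Q) (by
      rw [Polynomial.eq_C_of_natDegree_eq_zero hd] at hQ0 ⊢
      simpa using hQ0)
    simpa using this
  | succ d ih =>
    obtain ⟨z, hz⟩ := Complex.exists_root (f := Q)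
      (Polynomial.natDegree_pos_iff_degree_pos.1 (by omega))
    obtain ⟨Q1, hQ1⟩ := Polynomial.dvd_iff_isRoot.2 hz
    have hX0 := Polynomial.X_sub_C_ne_zero z
    have hQ10 : Q1 ≠ 0 := by rintro rfl; simp at hQ1; exact hQ0 hQ1
    have hzre : z.re ≠ 0 := fun h => hQ z.im (by rw [← eq_I_mul_of_re_eq_zero h]; exact hz)
    obtain ⟨b, hb, hbb, hreg⟩ := ih Q1 (fun ω h => hQ ω (by rw [hQ1]; simp [h])) hQ10 (by
      rw [hQ1, Polynomial.natDegree_mul hX0 hQ10, Polynomial.natDegree_X_sub_C] at hd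
      omega)
    rcases lt_or_gt_of_ne hzre with hneg | hposre
    · refine ⟨b, hb, hbb, fun s hs => ?_⟩
      rw [hQ1, map_mul, mul_inv, mul_left_comm]
      refine mul_mem (inv_X_sub_C_mem_regularAt ?_) (hreg s hs)
      rintro rfl; linarith
    · set ℓ := algebraMap (Polynomial ℂ) (RatFunc ℂ) (Polynomial.X - Polynomial.C z) with hℓ
      set ℓ' := algebraMap (Polynomial ℂ) (RatFunc ℂ) (Polynomial.X - Polynomial.C (-star z))
        with hℓ'
      have hℓ0 : ℓ ≠ 0 := RatFunc.algebraMap_ne_zero hX0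
      have hℓ0' : ℓ' ≠ 0 := RatFunc.algebraMap_ne_zero (Polynomial.X_sub_C_ne_zero _)
      have hstar : star ℓ = -ℓ' := by
        rw [hℓ, star_algebraMap, polyParaConj_X_sub_C, hℓ', ← map_neg]; simp
      have hstar' : star ℓ' = -ℓ := by
        rw [← star_star ℓ, hstar, star_neg, neg_neg]
      have hreg' : ∀ s : ℂ, 0 ≤ s.re → ℓ'⁻¹ ∈ regularAt s := fun s hs => by
        refine inv_X_sub_C_mem_regularAt ?_
        rintro rfl; simp at hs; linarith
      refine ⟨ℓ / ℓ' * b, mul_mem (mem_stableRing.2 ⟨div_mem_properRing (by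
          rw [Polynomial.natDegree_X_sub_C, Polynomial.natDegree_X_sub_C]), fun s hs => ?_⟩) hb,
        ?_, fun s hs => ?_⟩
      · rw [div_eq_mul_inv]
        exact mul_mem (algebraMap_mem_regularAt _ _) (hreg' s hs)
      · have h : ℓ / ℓ' * star (ℓ / ℓ') = 1 := by
          rw [star_div₀, hstar, hstar']; field_simp
        rw [star_mul]
        calc _ = (ℓ / ℓ' * star (ℓ / ℓ')) * (b * star b) := by ring
          _ = 1 := by rw [h, hbb, one_mul]
      · have : ℓ / ℓ' * b * (algebraMap (Polynomial ℂ) (RatFunc ℂ) Q)⁻¹ =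
            ℓ'⁻¹ * (b * (algebraMap (Polynomial ℂ) (RatFunc ℂ) Q1)⁻¹) := by
          rw [hQ1, map_mul, ← hℓ, mul_inv]
          field_simp
        rw [this]
        exact mul_mem (hreg' s hs) (hreg s hs)

theorem exists_inner_mul_mem_stableRing {f : RatFunc ℂ} (hf : f ∈ axisRing) :
    ∃ b ∈ stableRing, b * star b = 1 ∧ b * f ∈ stableRing := by
  obtain ⟨hp, hr⟩ := mem_axisRing.1 hf
  obtain ⟨b, hb, hbb, hreg⟩ := exists_inner_div_regular f.denom (fun ω => hr ω)
  refine ⟨b, hb, hbb, mem_stableRing.2 ⟨mul_mem (mem_stableRing.1 hb).1 hp, fun s hs => ?_⟩⟩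
  have h := mul_mem (hreg s hs) (algebraMap_mem_regularAt s f.num)
  rwa [mul_assoc, mul_comm _⁻¹, ← div_eq_mul_inv, RatFunc.num_div_denom] at h

/-- The product of the multipliers of all entries stabilizes every entry at once. Being scalar, c
commutes with matrices, and cc^H = 1 leaves products such as HH^H unchanged. -/
theorem exists_inner_smul_stable {a b : Type} [Fintype a] [Fintype b] {H : TransferMatrix a b}
    (hH : EntriesIn axisRing H) :
    ∃ c ∈ stableRing, c * star c = 1 ∧ EntriesIn stableRing (c • H) := by
  classical
  choose β hβ hββ hβH using fun ij : a × b => exists_inner_mul_mem_stableRing (hH ij.1 ij.2)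
  refine ⟨∏ ij, β ij, prod_mem fun ij _ => hβ ij, ?_, fun i j => ?_⟩
  · rw [star_prod, ← Finset.prod_mul_distrib]
    exact Finset.prod_eq_one fun ij _ => hββ ij
  · rw [Matrix.smul_apply, smul_eq_mul, ← Finset.mul_prod_erase _ _ (Finset.mem_univ (i, j)),
      mul_right_comm]
    exact mul_mem (hβH (i, j)) (prod_mem fun ij _ => hβ ij)

/-- As WW^H = I, the matrix P = I - W^HW is a para-Hermitian projection with WP = 0, and [W 0; P
W^H] is paraunitary. Its second row may be unstable, so it is multiplied by a scalar inner c, which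
preserves paraunitarity. -/
theorem exists_paraunitary_completion {a b : Type} [Fintype a] [DecidableEq a] [Fintype b]
    [DecidableEq b] {W : TransferMatrix a b} (hW : EntriesIn stableRing W) (hWW : W * Wᴴ = 1) :
    ∃ H : TransferMatrix (a ⊕ b) (b ⊕ a), EntriesIn stableRing H ∧ Hᴴ * H = 1 ∧ H * Hᴴ = 1 ∧
      ∀ i j, H (Sum.inl i) (Sum.inl j) = W i j := by
  have hWax := hW.mono stableRing_le_axisRing
  obtain ⟨c, -, hc, hst⟩ := exists_inner_smul_stable
    ((EntriesIn.one.sub (hWax.conjTranspose.mul hWax)).fromCols hWax.conjTranspose)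
  have hc' : star c * c = 1 := by rw [mul_comm]; exact hc
  set P : TransferMatrix b b := 1 - Wᴴ * W with hP
  have hPH : Pᴴ = P := by
    rw [hP, conjTranspose_sub, conjTranspose_one, conjTranspose_mul, conjTranspose_conjTranspose]
  have hWP : W * P = 0 := by
    rw [hP, Matrix.mul_sub, Matrix.mul_one, ← Matrix.mul_assoc, hWW, Matrix.one_mul, sub_self]
  have hPW : P * Wᴴ = 0 := by
    have := congrArg conjTranspose hWP
    rwa [conjTranspose_mul, hPH, conjTranspose_zero] at this
  have hPP : P * P = P := by
    conv_lhs => lhs; rw [hP]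
    rw [Matrix.sub_mul, Matrix.one_mul, Matrix.mul_assoc, hWP, Matrix.mul_zero, sub_zero]
  have hsum : P + Wᴴ * W = 1 := by rw [hP]; abel
  clear_value P
  refine ⟨fromBlocks W 0 (c • P) (c • Wᴴ), ?_, ?_, ?_, fun _ _ => rfl⟩
  · exact hW.fromBlocks EntriesIn.zero (fun i j => hst i (Sum.inl j)) (fun i j => hst i (Sum.inr j))
  · rw [fromBlocks_conjTranspose, fromBlocks_multiply, ← fromBlocks_one]
    simp only [conjTranspose_smul, hPH, conjTranspose_conjTranspose, conjTranspose_zero,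
      Matrix.smul_mul, Matrix.mul_smul, smul_smul, hc', hc, one_smul, hPP, hPW, hWP, hWW,
      Matrix.mul_zero, Matrix.zero_mul, zero_add, add_zero]
    rw [add_comm, hsum]
  · rw [fromBlocks_conjTranspose, fromBlocks_multiply, ← fromBlocks_one]
    simp only [conjTranspose_smul, hPH, conjTranspose_conjTranspose, conjTranspose_zero,
      Matrix.smul_mul, Matrix.mul_smul, smul_smul, hc', hc, one_smul, hPP, hPW, hWP, hWW,
      Matrix.mul_zero, Matrix.zero_mul, zero_add, add_zero, smul_zero]
    rw [hsum]

/-- A stable strictly contractive transfer matrix is the block of an admissible filter. -/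
theorem exists_isAdmissible_of_strictly_contractive {n ny : ℕ}
    {H11 : TransferMatrix (Fin n) (Fin ny)} (hH : EntriesIn stableRing H11)
    (hc : OnClosedAxis H11 (fun M => (1 - M * Mᴴ).PosDef)) :
    ∃ (nz nzh : ℕ) (H : TransferMatrix (Fin n ⊕ Fin nzh) (Fin ny ⊕ Fin nz)),
      IsAdmissible H ∧ H.toBlocks₁₁ = H11 := by
  have hHax := hH.mono stableRing_le_axisRing
  rw [onClosedAxis_iff hHax.proper] at hc
  have hprod := hHax.mul hHax.conjTranspose
  obtain ⟨r, W, hW, hWW⟩ := exists_matrix_spectral_factor (1 - H11 * H11ᴴ)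
    (EntriesIn.one.sub hprod)
    (by rw [conjTranspose_sub, conjTranspose_one, conjTranspose_mul, conjTranspose_conjTranspose])
    (by
      intro l hl V hV
      have := hl.neBot
      obtain ⟨U, hU⟩ := exists_tendsto_freq hl hHax.proper
      have h1 := tendsto_freq_mul hHax hHax.conjTranspose hU (tendsto_freq_conjTranspose hHax hU)
      have h2 : Tendsto (freq (1 - H11 * H11ᴴ)) l
          (𝓝 ((1 : Matrix (Fin n) (Fin n) ℂ) - U * Uᴴ)) := by
        rw [show freq (1 - H11 * H11ᴴ) = fun ω => 1 - freq (H11 * H11ᴴ) ω from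
          funext fun ω => by rw [freq_sub EntriesIn.one hprod, freq_one]]
        exact tendsto_const_nhds.sub h1
      rw [tendsto_nhds_unique hV h2]
      exact hc l hl U hU)
  -- The spectral factor W is only known to be regular on the closed axis. Multiplying by c makes it
  -- stable without changing WW^H.
  obtain ⟨c, -, hcc, hcW⟩ := exists_inner_smul_stable hW
  have hrow : fromCols H11 (c • W) * (fromCols H11 (c • W))ᴴ = 1 := by
    rw [conjTranspose_fromCols_eq_fromRows_conjTranspose, fromCols_mul_fromRows, conjTranspose_smul,
      Matrix.smul_mul, Matrix.mul_smul, smul_smul, hcc, one_smul, ← hWW]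
    abel
  obtain ⟨H, hst, h1, h2, h11⟩ := exists_paraunitary_completion (hH.fromCols hcW) hrow
  let er : Fin n ⊕ Fin (ny + r) ≃ Fin n ⊕ (Fin ny ⊕ Fin r) :=
    Equiv.sumCongr (Equiv.refl _) finSumFinEquiv.symm
  let ec : Fin ny ⊕ Fin (r + n) ≃ (Fin ny ⊕ Fin r) ⊕ Fin n :=
    (Equiv.sumCongr (Equiv.refl _) finSumFinEquiv.symm).trans (Equiv.sumAssoc _ _ _).symm
  have hst' : EntriesIn stableRing (H.submatrix er ec) := fun i j => hst _ _
  obtain ⟨hp, hs⟩ := isProper_and_isStable_iff.2 hst'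
  refine ⟨r + n, ny + r, H.submatrix er ec, ⟨hp, hs, ?_, ?_⟩, ?_⟩
  · rw [paraConj_eq_conjTranspose, conjTranspose_submatrix, submatrix_mul_equiv, h1,
      submatrix_one_equiv]
  · rw [paraConj_eq_conjTranspose, conjTranspose_submatrix, submatrix_mul_equiv, h2,
      submatrix_one_equiv]
  · ext i j
    exact h11 i (Sum.inl j)

/-! ### The main theorem -/

theorem Channel.IsSpectralFactor.axisRing {n nw ny nd k p : ℕ} {S : Channel n nw ny nd k} {lam : ℝ}
    {Ups : TransferMatrix (Fin ny ⊕ Fin n) (Fin p)} (h : S.IsSpectralFactor lam Ups)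
    (hp : EntriesIn properRing Ups) : EntriesIn axisRing Ups := by
  obtain ⟨-, τ, hτ, hpole⟩ := h
  refine fun i j => mem_axisRing.2 ⟨hp i j, fun ω hroot => ?_⟩
  have := hpole _ ⟨i, j, hroot⟩
  simp at this
  linarith

/-- The auxiliary problem and the equalization problem have the same value. -/
theorem Channel.gammaContractive_eq_gammaOpt {n nw ny nd k : ℕ} {S : Channel n nw ny nd k} {γ : ℝ}
    (hPhi : EntriesIn axisRing S.Phi) (hγ : 0 < γ) (hlow : S.LowSNRCondition γ)
    (hne : (S.contractiveSet γ).Nonempty) : S.gammaContractive = S.gammaOpt := by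
  refine le_antisymm (le_sInf ?_) (le_sInf ?_)
  · rintro _ ⟨γ', ⟨hγ', nz, nzh, H, ⟨hp, hs, -, hu⟩, hb⟩, rfl⟩
    -- The low signal-to-noise condition at γ controls levels γ' ≤ γ only. For γ' ≥ γ the assumed
    -- member of the contractive set at level γ suffices.
    rcases le_total γ γ' with hle | hle
    · have h : S.gammaContractive ≤ (γ : EReal) := sInf_le ⟨γ, ⟨hγ, hne⟩, rfl⟩
      exact h.trans (EReal.coe_le_coe_iff.2 hle)
    · have hst := isProper_and_isStable_iff.1 ⟨hp, hs⟩
      have hst' : EntriesIn stableRing H.toBlocks₁₁ := fun i j => hst _ _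
      obtain ⟨hp', hs'⟩ := isProper_and_isStable_iff.2 hst'
      rw [S.errorPSD_eq_blockPSD H hu] at hb
      refine sInf_le ⟨γ', ⟨hγ', H.toBlocks₁₁, hp', hs', hb, ?_⟩, rfl⟩
      exact S.strictly_contractive_of_bounded hPhi (hst'.mono stableRing_le_axisRing) hlow
        (pow_le_pow_left₀ hγ'.le hle 2) hb
  · rintro _ ⟨γ', ⟨hγ', H11, hp, hs, hb, hc⟩, rfl⟩
    obtain ⟨nz, nzh, H, hH, rfl⟩ := exists_isAdmissible_of_strictly_contractive
      (isProper_and_isStable_iff.1 ⟨hp, hs⟩) hc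
    refine sInf_le ⟨γ', ⟨hγ', nz, nzh, H, hH, ?_⟩, rfl⟩
    rwa [S.errorPSD_eq_blockPSD H hH.2.2.2]

end CoherentEqualization

end

theorem theorem3
    {n nw ny nd k m p q : ℕ}
    (S : CoherentEqualization.Channel n nw ny nd k)
    (lam : ℝ) (hlam : 0 ≤ lam)
    (Ups : CoherentEqualization.TransferMatrix (Fin ny ⊕ Fin n) (Fin p))
    (hUps : S.IsSpectralFactor lam Ups)
    (R : CoherentEqualization.FactorData m n ny p)
    (hR : R.IsMinimalRealizationOf Ups)
    (Nc : Matrix (Fin m ⊕ Fin p) (Fin q) ℂ)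
    (hNc : R.IsKernelBasis Nc)
    (γbar γ : ℝ)
    (hγ : γ = Real.sqrt (γbar ^ 2 - lam ^ 2))
    (hfeas : (∃ m11 : ℕ, R.RankFeasible m11 lam Nc γbar) ∨ R.Feasible lam Nc γbar)
    (h21 : S.LowSNRCondition γ) :
    -- the set of contractive suboptimal transfer functions is not empty
    0 < γ ∧ (S.contractiveSet γ).Nonempty ∧
    -- the performance values
    S.gammaContractive ≤ (γ : EReal) ∧ S.gammaContractive = S.gammaOpt ∧
    -- the filter inequality is solvable with state dimension `m11` under the rank constraint,
    -- and with state dimension `m` in any case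
    (∀ m11 : ℕ, (R.RankFeasible m11 lam Nc γbar ∨ m11 = m) →
      ∃ (F : CoherentEqualization.FilterData m11 n ny)
        (X : Matrix (Fin m ⊕ Fin m11) (Fin m ⊕ Fin m11) ℂ), R.FilterLMI γbar F X) ∧
    -- every solution of the filter inequality yields an element of the set
    (∀ (m11 : ℕ) (F : CoherentEqualization.FilterData m11 n ny)
        (X : Matrix (Fin m ⊕ Fin m11) (Fin m ⊕ Fin m11) ℂ),
      R.FilterLMI γbar F X → F.toTransfer ∈ S.contractiveSet γ) := by
  -- The pole condition excludes only finite poles on the axis; properness of Υ comes from its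
  -- having a state-space realization.
  have hax : CoherentEqualization.EntriesIn CoherentEqualization.axisRing Ups :=
    hUps.axisRing (hR.1 ▸ CoherentEqualization.transfer_proper _ _ _ _)
  have hfeas' : R.Feasible lam Nc γbar := by
    rcases hfeas with ⟨_, X1, Y1, h, _⟩ | h
    exacts [⟨X1, Y1, h⟩, h]
  obtain ⟨X1, Y1, hXY⟩ := hfeas'
  have hpos : 0 < γ := by
    rw [hγ]; exact Real.sqrt_pos.2 (sub_pos.2 hXY.1)
  have hsq : γ ^ 2 = γbar ^ 2 - lam ^ 2 := by
    rw [hγ, Real.sq_sqrt (sub_pos.2 hXY.1).le]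
  have hsolve : ∀ m11 : ℕ, (R.RankFeasible m11 lam Nc γbar ∨ m11 = m) →
      ∃ (F : CoherentEqualization.FilterData m11 n ny)
        (X : Matrix (Fin m ⊕ Fin m11) (Fin m ⊕ Fin m11) ℂ), R.FilterLMI γbar F X := by
    rintro m11 (⟨X1, Y1, h, hr⟩ | rfl)
    · exact R.exists_filterLMI hNc h hr
    -- For m₁₁ = m the rank bound is m + m, the size of the matrix, so it always holds.
    · refine R.exists_filterLMI hNc hXY ((Matrix.rank_le_card_width _).trans ?_)
      simp
  have hmem : ∀ (m11 : ℕ) (F : CoherentEqualization.FilterData m11 n ny)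
      (X : Matrix (Fin m ⊕ Fin m11) (Fin m ⊕ Fin m11) ℂ),
      R.FilterLMI γbar F X → F.toTransfer ∈ S.contractiveSet γ := fun m11 F X h =>
    S.mem_contractiveSet_of_filterLMI hUps.1 hax hR.1 hsq h21 h
  have hne : (S.contractiveSet γ).Nonempty := by
    obtain ⟨F, X, h⟩ := hsolve m (Or.inr rfl)
    exact ⟨_, hmem m F X h⟩
  exact ⟨hpos, hne, sInf_le ⟨γ, ⟨hpos, hne⟩, rfl⟩,
    CoherentEqualization.Channel.gammaContractive_eq_gammaOpt (S.Phi_axisRing hUps.1 hax) hpos h21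
      hne, hsolve, hmem⟩
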